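/- Let $k$ be an algebraically closed field of characteristic $0$. Let $A=(a_{ij})$ be a generalized Cartan matrix indexed by a finite set $I$, and let $(\mathfrak h,\Pi,\Pi^\vee)$ be a realization of $A$: $\mathfrak h$ is a finite-dimensional vector space, $\Pi=\{\alpha_i\}\subset\mathfrak h^*$ and $\Pi^\vee=\{\alpha_i^\vee\}\subset\mathfrak h$ are linearly independent, and $\langle\alpha_i^\vee,\alpha_j\rangle=a_{ij}$ (minimality of $\dim\mathfrak h$ is allowed but not required). Let $\tilde{\mathfrak g}$ be the Lie algebra generated by $\mathfrak h$, $e_i$, $f_i$ with relations $[t,t']=0$, $[t,e_i]=\alpha_i(t)e_i$, $[t,f_i]=-\alpha_i(t)f_i$, $[e_i,f_j]=\delta_{ij}\alpha_i^\vee$, and let $\mathfrak g$ be the Kac–Moody algebra, that is, the quotient of $\tilde{\mathfrak g}$ either by the sum of all ideals meeting $\mathfrak h$ trivially, or by the Serre relations $\mathrm{ad}(e_i)^{1-a_{ij}}e_j=0=\mathrm{ad}(f_i)^{1-a_{ij}}f_j$ $(i\ne j)$; the statement holds for both. Let $\Delta=\Delta^+\sqcup\Delta^-$ be the set of roots and $\mathfrak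 g_\alpha$ the root spaces, and let $\tau$ be the anti-involution of $\mathfrak g$ and of $U\mathfrak g$ with $\tau(e_i)=f_i$, $\tau(f_i)=e_i$, $\tau|_{\mathfrak h}=\mathrm{id}$. For $\Xi\subset\Pi$ put $\Delta_\Xi=\Delta\cap\mathbb Z\Xi$, $\Delta_\Xi^\pm=\Delta_\Xi\cap\Delta^\pm$, and $$\mathfrak l_\Xi=\mathfrak h\oplus\bigoplus_{\alpha\in\Delta_\Xi}\mathfrak g_\alpha,\qquad \mathfrak u_\Xi^\pm=\bigoplus_{\alpha\in\Delta^\pm\setminus\Delta_\Xi^\pm}\mathfrak g_\alpha,\qquad \mathfrak p_\Xi^\pm=\mathfrak l_\Xi\oplus\mathfrak u_\Xi^\pm .$$ For an $\mathfrak l_\Xi$-module $N$, inflated to $\mathfrak p_\Xi^\pm$ along $\mathfrak p_\Xi^\pm\twoheadrightarrow\mathfrak l_\Xi$, put $$\mathrm{Ind}_{\Xi,!}(N)=U\mathfrak g\otimes_{U\mathfrak p_\Xi^+}N,\qquad \mathrm{Ind}_{\Xi,*}(N)=\mathrm{Hom}_{U\mathfrak p_\Xi^-}(U\mathfrak g,N),$$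 where in the second formula $U\mathfrak g$ is a $(U\mathfrak p^-_\Xi,U\mathfrak g)$-bimodule through $\tau$: its elements are the linear maps $\varphi\colon U\mathfrak g\to N$ with $\varphi(X\tau(Y))=Y\varphi(X)$ for $Y\in U\mathfrak p^-_\Xi$, and $(Z\varphi)(X)=\varphi(\tau(Z)X)$ for $Z\in U\mathfrak g$. A module over $\mathfrak g$ or $\mathfrak l_\Xi$ is a weight module if it is the direct sum of its $\mathfrak h$-weight spaces. Let $N$ be a weight $\mathfrak l_\Xi$-module that is simple. Then there is exactly one homomorphism of $\mathfrak g$-modules $\Phi\colon\mathrm{Ind}_{\Xi,!}(N)\to\mathrm{Ind}_{\Xi,*}(N)$ with $\Phi(1\otimes n)(1)=n$ for all $n\in N$ (the natural map, corresponding to $\mathrm{id}_N$ by adjunction), and its image, the minimal parabolic induction $\mathrm{Ind}_{\Xi,!*}(N)=\operatorname{im}\Phi$, is a weight $\mathfrak g$-module and is simple. Moreover, $\ker\Phi$ is the largest $\mathfrak g$-submodule of $\mathrm{Ind}_{\Xi,!}(N)$ that meets $1\otimes N$ trivially: a $\mathfrak g$-submodule $M$ is contained in $\ker\Phi$ if and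 only if $M\cap(1\otimes N)=0$. -/

import Mathlib

open scoped TensorProduct
open Module

/-- A generalized Cartan matrix `A` together with a realization of it: linearly independent simple
roots `α i ∈ h*` and linearly independent simple coroots `α∨ i ∈ h` with `⟨α∨ i, α j⟩ = A i j`.
The minimality condition `dim h = 2 |ι| - rank A` is not imposed, so that minimal realizations and
larger Cartan subalgebras are both covered. -/
structure KacMoodyDatum (k ι h : Type*) [Field k] [AddCommGroup h] [Module k h] where
  A : Matrix ι ι ℤ
  diag : ∀ i, A i i = 2
  offDiag : ∀ i j, i ≠ j → A i j ≤ 0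
  zeroPattern : ∀ i j, A i j = 0 → A j i = 0
  root : ι → Dual k h
  coroot : ι → h
  root_indep : LinearIndependent k root
  coroot_indep : LinearIndependent k coroot
  pairing : ∀ i j, root j (coroot i) = (A i j : k)

/-- There are two customary definitions of the Kac-Moody algebra attached to a realization: divide
the auxiliary algebra by the largest ideal meeting the Cartan subalgebra trivially, or divide it by
the Serre relations. They agree for symmetrizable matrices. We treat both. -/
inductive KacMoodyConvention
  | radical
  | serre

noncomputable section

namespace KacMoodyDatum

attribute [local instance] LieRing.ofAssociativeRing

variable {k ι h : Type*} [Field k] [AddCommGroup h] [Module k h]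

/-- Symbols generating the auxiliary Lie algebra: `e i`, `f i`, and the elements of `h`. -/
inductive Gen (ι h : Type*)
  | e : ι → Gen ι h
  | f : ι → Gen ι h
  | t : h → Gen ι h

/-- A symbol, as an element of the free Lie algebra. -/
abbrev sym (_ : KacMoodyDatum k ι h) (g : Gen ι h) : FreeLieAlgebra k (Gen ι h) :=
  FreeLieAlgebra.of k g

/-- The defining relators of the auxiliary Lie algebra. -/
inductive Relator (D : KacMoodyDatum k ι h) : FreeLieAlgebra k (Gen ι h) → Prop
  | add (x y : h) : Relator D (D.sym (.t (x + y)) - (D.sym (.t x) + D.sym (.t y)))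
  | smul (a : k) (x : h) : Relator D (D.sym (.t (a • x)) - a • D.sym (.t x))
  | tt (x y : h) : Relator D ⁅D.sym (.t x), D.sym (.t y)⁆
  | te (x : h) (i : ι) : Relator D (⁅D.sym (.t x), D.sym (.e i)⁆ - D.root i x • D.sym (.e i))
  | tf (x : h) (i : ι) : Relator D (⁅D.sym (.t x), D.sym (.f i)⁆ + D.root i x • D.sym (.f i))
  | ef (i : ι) : Relator D (⁅D.sym (.e i), D.sym (.f i)⁆ - D.sym (.t (D.coroot i)))
  | ef_ne (i j : ι) (hij : i ≠ j) : Relator D ⁅D.sym (.e i), D.sym (.f j)⁆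

/-- The auxiliary Lie algebra: generators `e i`, `f i`, `h`, and only the relations `Relator`. -/
def Aux (D : KacMoodyDatum k ι h) : Type _ :=
  FreeLieAlgebra k (Gen ι h) ⧸
    (LieSubmodule.lieSpan k (FreeLieAlgebra k (Gen ι h)) {x | D.Relator x} :
      LieIdeal k (FreeLieAlgebra k (Gen ι h)))

instance (D : KacMoodyDatum k ι h) : LieRing D.Aux :=
  inferInstanceAs (LieRing (FreeLieAlgebra k (Gen ι h) ⧸
    (LieSubmodule.lieSpan k (FreeLieAlgebra k (Gen ι h)) {x | D.Relator x} :
      LieIdeal k (FreeLieAlgebra k (Gen ι h)))))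

instance (D : KacMoodyDatum k ι h) : LieAlgebra k D.Aux :=
  inferInstanceAs (LieAlgebra k (FreeLieAlgebra k (Gen ι h) ⧸
    (LieSubmodule.lieSpan k (FreeLieAlgebra k (Gen ι h)) {x | D.Relator x} :
      LieIdeal k (FreeLieAlgebra k (Gen ι h)))))

section Quot

variable {L L' : Type*} [LieRing L] [LieAlgebra k L] [LieRing L'] [LieAlgebra k L']

/-- The quotient map by a Lie ideal, as a homomorphism of Lie algebras. -/
def quotMk (I : LieIdeal k L) : L →ₗ⁅k⁆ L ⧸ I :=
  { (LieSubmodule.Quotient.mk' I : L →ₗ[k] L ⧸ I) with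
    map_lie' := fun {x y} => LieSubmodule.Quotient.mk_bracket (I := I) x y }

/-- A homomorphism of Lie algebras vanishing on an ideal descends to the quotient. -/
def quotLift (I : LieIdeal k L) (g : L →ₗ⁅k⁆ L') (hg : ∀ x ∈ I, g x = 0) : L ⧸ I →ₗ⁅k⁆ L' :=
  { Submodule.liftQ I.toSubmodule (g : L →ₗ[k] L') (fun x hx => hg x hx) with
    map_lie' := fun {x y} => by
      obtain ⟨x, rfl⟩ := Submodule.Quotient.mk_surjective _ x
      obtain ⟨y, rfl⟩ := Submodule.Quotient.mk_surjective _ y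
      exact LieHom.map_lie g x y }

theorem quotMk_surjective (I : LieIdeal k L) : Function.Surjective (quotMk I) :=
  Submodule.Quotient.mk_surjective _

theorem quotMk_eq_zero (I : LieIdeal k L) {x : L} (hx : x ∈ I) : quotMk I x = 0 :=
  (Submodule.Quotient.mk_eq_zero I.toSubmodule).2 hx

@[simp] theorem quotLift_mk (I : LieIdeal k L) (g : L →ₗ⁅k⁆ L') (hg : ∀ x ∈ I, g x = 0) (x : L) :
    quotLift I g hg (quotMk I x) = g x := rfl

end Quot

variable (D : KacMoodyDatum k ι h)

/-- The canonical map from the free Lie algebra to the auxiliary one. -/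
def toAux : FreeLieAlgebra k (Gen ι h) →ₗ⁅k⁆ D.Aux :=
  quotMk (LieSubmodule.lieSpan k (FreeLieAlgebra k (Gen ι h)) {x | D.Relator x})

theorem toAux_surjective : Function.Surjective D.toAux := quotMk_surjective _

theorem toAux_relator {x : FreeLieAlgebra k (Gen ι h)} (hx : D.Relator x) : D.toAux x = 0 :=
  quotMk_eq_zero _ (LieSubmodule.subset_lieSpan hx)

/-- The generator of the auxiliary Lie algebra attached to a symbol. -/
def auxGen (x : Gen ι h) : D.Aux := D.toAux (FreeLieAlgebra.of k x)

/-- The map from the Cartan subalgebra to the auxiliary Lie algebra. -/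
def auxCartan : h →ₗ[k] D.Aux where
  toFun x := D.auxGen (.t x)
  map_add' x y := by
    have := D.toAux_relator (.add x y)
    rwa [map_sub, map_add, sub_eq_zero] at this
  map_smul' c x := by
    have := D.toAux_relator (.smul c x)
    rwa [map_sub, map_smul, sub_eq_zero] at this

/-- The images of the symbols under the Chevalley involution: `e i ↦ - f i`, `f i ↦ - e i`,
`t ↦ - t`. -/
def chevalleyGen : Gen ι h → FreeLieAlgebra k (Gen ι h)
  | .e i => - FreeLieAlgebra.of k (.f i)
  | .f i => - FreeLieAlgebra.of k (.e i)
  | .t x => - FreeLieAlgebra.of k (.t x)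

theorem lift_chevalleyGen_relator {x : FreeLieAlgebra k (Gen ι h)} (hx : D.Relator x) :
    D.toAux (FreeLieAlgebra.lift k chevalleyGen x) = 0 := by
  induction hx with
  | add x y =>
    have := D.toAux_relator (.add x y)
    simp only [map_sub, map_add, FreeLieAlgebra.lift_of_apply, chevalleyGen, map_neg] at this ⊢
    rw [← neg_eq_zero, ← this]; abel
  | smul c x =>
    have := D.toAux_relator (.smul c x)
    simp only [map_sub, map_smul, FreeLieAlgebra.lift_of_apply, chevalleyGen, map_neg] at this ⊢
    rw [← neg_eq_zero, ← this, smul_neg]; abel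
  | tt x y =>
    have := D.toAux_relator (.tt x y)
    simpa [chevalleyGen] using this
  | te x i =>
    have := D.toAux_relator (.tf x i)
    simpa [chevalleyGen] using this
  | tf x i =>
    have := D.toAux_relator (.te x i)
    simpa [chevalleyGen, sub_eq_add_neg] using this
  | ef i =>
    have := D.toAux_relator (.ef i)
    simp only [map_sub, LieHom.map_lie, FreeLieAlgebra.lift_of_apply, chevalleyGen, map_neg,
      neg_lie, lie_neg, neg_neg] at this ⊢
    rw [← lie_skew, ← neg_eq_zero, ← this]; abel
  | ef_ne i j hij =>
    have := D.toAux_relator (.ef_ne j i hij.symm)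
    simp only [LieHom.map_lie, FreeLieAlgebra.lift_of_apply, chevalleyGen,
      neg_lie, lie_neg, neg_neg] at this ⊢
    rw [← lie_skew, this, neg_zero]

/-- The Chevalley involution of the auxiliary Lie algebra. -/
def auxChevalley : D.Aux →ₗ⁅k⁆ D.Aux :=
  quotLift _ (D.toAux.comp (FreeLieAlgebra.lift k chevalleyGen)) (by
    have : (LieSubmodule.lieSpan k (FreeLieAlgebra k (Gen ι h)) {x | D.Relator x} :
        LieIdeal k (FreeLieAlgebra k (Gen ι h))) ≤
        (D.toAux.comp (FreeLieAlgebra.lift k chevalleyGen)).ker :=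
      LieSubmodule.lieSpan_le.2 fun x hx =>
        LieHom.mem_ker.2 (D.lift_chevalleyGen_relator hx)
    exact fun x hx => LieHom.mem_ker.1 (this hx))

theorem auxChevalley_e (i : ι) : D.auxChevalley (D.auxGen (.e i)) = - D.auxGen (.f i) := by
  change D.toAux (FreeLieAlgebra.lift k chevalleyGen _) = _
  simp [chevalleyGen, auxGen]

theorem auxChevalley_f (i : ι) : D.auxChevalley (D.auxGen (.f i)) = - D.auxGen (.e i) := by
  change D.toAux (FreeLieAlgebra.lift k chevalleyGen _) = _
  simp [chevalleyGen, auxGen]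

theorem auxChevalley_t (x : h) : D.auxChevalley (D.auxCartan x) = - D.auxCartan x := by
  change D.toAux (FreeLieAlgebra.lift k chevalleyGen _) = - D.toAux _
  simp [chevalleyGen]

theorem auxChevalley_auxChevalley (x : D.Aux) : D.auxChevalley (D.auxChevalley x) = x := by
  obtain ⟨x, rfl⟩ := D.toAux_surjective x
  have : (D.auxChevalley.comp D.auxChevalley).comp D.toAux = D.toAux := by
    ext g
    simp only [LieHom.comp_apply]
    change D.auxChevalley (D.auxChevalley (D.auxGen g)) = D.auxGen g
    cases g with
    | e i => simp [auxChevalley_e, auxChevalley_f]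
    | f i => simp [auxChevalley_e, auxChevalley_f]
    | t x =>
      change D.auxChevalley (D.auxChevalley (D.auxCartan x)) = D.auxCartan x
      simp [auxChevalley_t]
  exact LieHom.congr_fun this x

/-- The ideal of the auxiliary Lie algebra defining the Kac-Moody algebra: either the sum of all
ideals meeting the Cartan subalgebra trivially, or the ideal of the Serre relations. -/
def kmIdeal : KacMoodyConvention → LieIdeal k D.Aux
  | .radical => sSup {J : LieIdeal k D.Aux | Disjoint J.toSubmodule (LinearMap.range D.auxCartan)}
  | .serre => LieSubmodule.lieSpan k D.Aux
      ({x | ∃ i j, i ≠ j ∧ x = ((LieAlgebra.ad k D.Aux (D.auxGen (.e i))) ^ (1 - D.A i j).toNat)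
          (D.auxGen (.e j))} ∪
       {x | ∃ i j, i ≠ j ∧ x = ((LieAlgebra.ad k D.Aux (D.auxGen (.f i))) ^ (1 - D.A i j).toNat)
          (D.auxGen (.f j))})

theorem auxChevalley_ad_pow (x y : D.Aux) (m : ℕ) :
    D.auxChevalley (((LieAlgebra.ad k D.Aux x) ^ m) y) =
      ((LieAlgebra.ad k D.Aux (D.auxChevalley x)) ^ m) (D.auxChevalley y) := by
  induction m with
  | zero => simp
  | succ m ih => simp [pow_succ', ih]

theorem neg_ad_pow (x y : D.Aux) (m : ℕ) :
    ((LieAlgebra.ad k D.Aux (-x)) ^ m) (-y) =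
      (-1 : k) ^ (m + 1) • ((LieAlgebra.ad k D.Aux x) ^ m) y := by
  induction m with
  | zero => simp
  | succ m ih => rw [pow_succ', Module.End.mul_apply, ih]; simp [pow_succ']

theorem auxChevalley_mem (c : KacMoodyConvention) (x : D.Aux) (hx : x ∈ D.kmIdeal c) :
    D.auxChevalley x ∈ D.kmIdeal c := by
  suffices D.kmIdeal c ≤ (D.kmIdeal c).comap D.auxChevalley from LieIdeal.mem_comap.1 (this hx)
  cases c with
  | radical =>
    refine sSup_le fun J hJ => ?_
    have hJ' : J.comap D.auxChevalley ≤ D.kmIdeal .radical := by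
      refine le_sSup ?_
      rw [Set.mem_ofPred_eq, Submodule.disjoint_def]
      rintro _ hx ⟨t, rfl⟩
      have h1 : D.auxChevalley (D.auxCartan t) ∈ J := LieIdeal.mem_comap.1 hx
      rw [auxChevalley_t, neg_mem_iff] at h1
      exact Submodule.disjoint_def.1 hJ _ h1 ⟨t, rfl⟩
    intro x hx
    refine LieIdeal.mem_comap.2 (hJ' (LieIdeal.mem_comap.2 ?_))
    rwa [auxChevalley_auxChevalley]
  | serre =>
    refine LieSubmodule.lieSpan_le.2 ?_
    rintro _ (⟨i, j, hij, rfl⟩ | ⟨i, j, hij, rfl⟩)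
    · refine LieIdeal.mem_comap.2 ?_
      rw [auxChevalley_ad_pow, auxChevalley_e, auxChevalley_e, neg_ad_pow]
      exact (D.kmIdeal .serre).smul_mem _ (LieSubmodule.subset_lieSpan (.inr ⟨i, j, hij, rfl⟩))
    · refine LieIdeal.mem_comap.2 ?_
      rw [auxChevalley_ad_pow, auxChevalley_f, auxChevalley_f, neg_ad_pow]
      exact (D.kmIdeal .serre).smul_mem _ (LieSubmodule.subset_lieSpan (.inl ⟨i, j, hij, rfl⟩))

/-- The Kac-Moody algebra. -/
def Alg (c : KacMoodyConvention) : Type _ := D.Aux ⧸ D.kmIdeal c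

variable (c : KacMoodyConvention)

instance : LieRing (D.Alg c) := inferInstanceAs (LieRing (D.Aux ⧸ D.kmIdeal c))

instance : LieAlgebra k (D.Alg c) := inferInstanceAs (LieAlgebra k (D.Aux ⧸ D.kmIdeal c))

/-- The quotient map from the auxiliary Lie algebra to the Kac-Moody algebra. -/
def toAlg : D.Aux →ₗ⁅k⁆ D.Alg c := quotMk (D.kmIdeal c)

/-- The Chevalley generator `e i`. -/
def e (i : ι) : D.Alg c := D.toAlg c (D.auxGen (.e i))

/-- The Chevalley generator `f i`. -/
def f (i : ι) : D.Alg c := D.toAlg c (D.auxGen (.f i))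

/-- The inclusion of the Cartan subalgebra. -/
def cartan : h →ₗ[k] D.Alg c := (D.toAlg c : D.Aux →ₗ[k] D.Alg c) ∘ₗ D.auxCartan

/-- The Chevalley involution of the Kac-Moody algebra. -/
def chevalley : D.Alg c →ₗ⁅k⁆ D.Alg c :=
  quotLift _ ((D.toAlg c).comp D.auxChevalley)
    fun x hx => quotMk_eq_zero _ (D.auxChevalley_mem c x hx)

/-- The transpose `τ`: the anti-involution of the Kac-Moody algebra with `τ (e i) = f i`,
`τ (f i) = e i` and `τ t = t` for `t` in the Cartan subalgebra. -/
def transpose : D.Alg c →ₗ[k] D.Alg c := -(D.chevalley c : D.Alg c →ₗ[k] D.Alg c)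

theorem transpose_e (i : ι) : D.transpose c (D.e c i) = D.f c i := by
  change -(D.toAlg c (D.auxChevalley _)) = _
  simp [auxChevalley_e, f]

theorem transpose_f (i : ι) : D.transpose c (D.f c i) = D.e c i := by
  change -(D.toAlg c (D.auxChevalley _)) = _
  simp [auxChevalley_f, e]

theorem transpose_cartan (t : h) : D.transpose c (D.cartan c t) = D.cartan c t := by
  change -(D.toAlg c (D.auxChevalley _)) = D.toAlg c _
  simp [auxChevalley_t]

theorem transpose_lie (x y : D.Alg c) :
    D.transpose c ⁅x, y⁆ = ⁅D.transpose c y, D.transpose c x⁆ := by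
  simp only [transpose, LinearMap.neg_apply, LieHom.coe_toLinearMap, LieHom.map_lie, neg_lie,
    lie_neg, lie_skew]

/-- The extension of the transpose to the universal enveloping algebra, as a homomorphism to the
opposite algebra. -/
def transposeHom : UniversalEnvelopingAlgebra k (D.Alg c) →ₐ[k]
    (UniversalEnvelopingAlgebra k (D.Alg c))ᵐᵒᵖ :=
  UniversalEnvelopingAlgebra.lift k
    { toFun := fun x => MulOpposite.op (UniversalEnvelopingAlgebra.ι k (D.transpose c x))
      map_add' := fun x y => by simp
      map_smul' := fun a x => by simp
      map_lie' := fun {x y} => by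
        rw [transpose_lie, LieHom.map_lie, LieRing.of_associative_ring_bracket,
          LieRing.of_associative_ring_bracket, MulOpposite.op_sub, MulOpposite.op_mul,
          MulOpposite.op_mul] }

/-- The transpose anti-involution `τ` of the universal enveloping algebra. -/
def τ (X : UniversalEnvelopingAlgebra k (D.Alg c)) : UniversalEnvelopingAlgebra k (D.Alg c) :=
  (D.transposeHom c X).unop

theorem τ_ι (x : D.Alg c) : D.τ c (UniversalEnvelopingAlgebra.ι k x) =
    UniversalEnvelopingAlgebra.ι k (D.transpose c x) := by
  rw [τ, transposeHom, UniversalEnvelopingAlgebra.lift_ι_apply]; rfl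

theorem τ_mul (X Y : UniversalEnvelopingAlgebra k (D.Alg c)) :
    D.τ c (X * Y) = D.τ c Y * D.τ c X := by simp [τ]

/-- The root space `g_α = {x | [t, x] = α(t) x for all t in the Cartan subalgebra}`. -/
def rootSpace (α : Dual k h) : Submodule k (D.Alg c) where
  carrier := {x | ∀ t : h, ⁅D.cartan c t, x⁆ = α t • x}
  add_mem' {x y} hx hy t := by rw [lie_add, hx t, hy t, smul_add]
  zero_mem' t := by simp
  smul_mem' a x hx t := by rw [lie_smul, hx t, smul_comm]

/-- The set `Δ` of roots. -/
def roots : Set (Dual k h) := {α | α ≠ 0 ∧ D.rootSpace c α ≠ ⊥}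

/-- `Q₊`: the non-negative integral combinations of the simple roots. -/
def posCone : AddSubmonoid (Dual k h) := AddSubmonoid.closure (Set.range D.root)

/-- The positive roots `Δ⁺` for `ε = 1`, and the negative roots `Δ⁻` for `ε = -1`. -/
def signedRoots (ε : ℤˣ) : Set (Dual k h) := {α | α ∈ D.roots c ∧ ε • α ∈ D.posCone}

/-- The lattice `ℤ Ξ` spanned by the simple roots in `Ξ`. -/
def leviLattice (Ξ : Set ι) : AddSubgroup (Dual k h) := AddSubgroup.closure (D.root '' Ξ)

/-- The set of roots `Δ_Ξ = Δ ∩ ℤ Ξ`. -/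
def leviRoots (Ξ : Set ι) : Set (Dual k h) := D.roots c ∩ D.leviLattice Ξ

/-- The underlying space `h ⊕ ⨁_{α ∈ Δ_Ξ} g_α` of the Levi subalgebra. -/
def leviSpace (Ξ : Set ι) : Submodule k (D.Alg c) :=
  LinearMap.range (D.cartan c) ⊔ ⨆ α ∈ D.leviRoots c Ξ, D.rootSpace c α

/-- The nilradical `u⁺_Ξ` (for `ε = 1`) and its opposite `u⁻_Ξ` (for `ε = -1`): the sum of the root
spaces for `Δ^± ∖ Δ_Ξ`. -/
def nilradical (ε : ℤˣ) (Ξ : Set ι) : Submodule k (D.Alg c) :=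
  ⨆ α ∈ D.signedRoots c ε \ D.leviRoots c Ξ, D.rootSpace c α

/-- The underlying space `⨁_{α ∈ Δ_Ξ ∩ Δ^∓} g_α ⊕ h ⊕ n^±` of the parabolic subalgebra `p^±_Ξ`. -/
def parabolicSpace (ε : ℤˣ) (Ξ : Set ι) : Submodule k (D.Alg c) :=
  (⨆ α ∈ D.leviRoots c Ξ ∩ D.signedRoots c (-ε), D.rootSpace c α) ⊔ LinearMap.range (D.cartan c) ⊔
    ⨆ α ∈ D.signedRoots c ε, D.rootSpace c α

section Structure

theorem cartan_lie_cartan (t s : h) : ⁅D.cartan c t, D.cartan c s⁆ = 0 := by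
  have := congrArg (D.toAlg c) (D.toAux_relator (.tt t s))
  rw [LieHom.map_lie, LieHom.map_lie, map_zero] at this
  exact this

theorem cartan_lie_e (t : h) (i : ι) : ⁅D.cartan c t, D.e c i⁆ = D.root i t • D.e c i := by
  have := congrArg (D.toAlg c) (D.toAux_relator (.te t i))
  rw [map_sub, LieHom.map_lie, map_sub, LieHom.map_lie, map_zero, sub_eq_zero, map_smul,
    map_smul] at this
  exact this

theorem cartan_lie_f (t : h) (i : ι) : ⁅D.cartan c t, D.f c i⁆ = -D.root i t • D.f c i := by
  have := congrArg (D.toAlg c) (D.toAux_relator (.tf t i))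
  rw [map_add, LieHom.map_lie, map_add, LieHom.map_lie, map_zero, add_eq_zero_iff_eq_neg, map_smul,
    map_smul, ← neg_smul] at this
  exact this

theorem e_lie_f (i j : ι) : ⁅D.e c i, D.f c j⁆ ∈ LinearMap.range (D.cartan c) := by
  by_cases hij : i = j
  · subst hij
    have := congrArg (D.toAlg c) (D.toAux_relator (.ef i))
    rw [map_sub, LieHom.map_lie, map_sub, LieHom.map_lie, map_zero, sub_eq_zero] at this
    exact ⟨D.coroot i, this.symm⟩
  · have := congrArg (D.toAlg c) (D.toAux_relator (.ef_ne i j hij))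
    rw [LieHom.map_lie, LieHom.map_lie, map_zero] at this
    refine ⟨0, ?_⟩
    rw [map_zero]
    exact this.symm

theorem lie_mem_rootSpace {α β : Dual k h} {x y : D.Alg c} (hx : x ∈ D.rootSpace c α)
    (hy : y ∈ D.rootSpace c β) : ⁅x, y⁆ ∈ D.rootSpace c (α + β) := by
  intro t
  rw [leibniz_lie, hx t, hy t, smul_lie, lie_smul, LinearMap.add_apply, add_smul]

theorem iSupIndep_rootSpace : iSupIndep (D.rootSpace c) := by
  have h1 := Module.End.independent_iInf_maxGenEigenspace_of_forall_mapsTo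
    (fun t : h => LieAlgebra.ad k (D.Alg c) (D.cartan c t)) (fun s t a =>
      Module.End.mapsTo_maxGenEigenspace_of_comm (by
        rw [commute_iff_lie_eq, ← LieHom.map_lie, cartan_lie_cartan, map_zero]) a)
  have h2 := h1.comp (f := fun α : Dual k h => (α : h → k)) DFunLike.coe_injective
  refine h2.mono fun α x hx => ?_
  simp only [Function.comp_apply, Submodule.mem_iInf]
  intro t
  refine (Module.End.genEigenspace _ _).mono (show (1 : ℕ∞) ≤ ⊤ from le_top) ?_
  rw [Module.End.genEigenspace_one, LinearMap.mem_ker]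
  simp [hx t]

theorem eq_top_of_generators (K : LieSubalgebra k (D.Alg c)) (he : ∀ i, D.e c i ∈ K)
    (hf : ∀ i, D.f c i ∈ K) (ht : ∀ t, D.cartan c t ∈ K) : K = ⊤ := by
  have hg : ∀ g : Gen ι h, D.toAlg c (D.auxGen g) ∈ K
    | .e i => he i
    | .f i => hf i
    | .t x => ht x
  let φ : FreeLieAlgebra k (Gen ι h) →ₗ⁅k⁆ K := FreeLieAlgebra.lift k fun g => ⟨_, hg g⟩
  have hφ : K.incl.comp φ = (D.toAlg c).comp D.toAux := by
    ext g
    simp [φ, auxGen]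
  rw [eq_top_iff]
  intro x _
  obtain ⟨y, rfl⟩ := quotMk_surjective _ x
  obtain ⟨z, rfl⟩ := D.toAux_surjective y
  have := LieHom.congr_fun hφ z
  change (φ z : D.Alg c) = D.toAlg c (D.toAux z) at this
  change D.toAlg c (D.toAux z) ∈ K
  rw [← this]
  exact (φ z).2

theorem exists_offHeight (Ξ : Set ι) :
    ∃ ℓ : Dual k h →ₗ[k] k, ∀ i, (i ∈ Ξ → ℓ (D.root i) = 0) ∧ (i ∉ Ξ → ℓ (D.root i) = 1) := by
  classical
  obtain ⟨ℓ, hℓ⟩ := LinearMap.exists_extend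
    ((Basis.span D.root_indep).constr k fun i => if i ∈ Ξ then (0 : k) else 1)
  refine ⟨ℓ, fun i => ?_⟩
  have h1 : ℓ (D.root i) = if i ∈ Ξ then (0 : k) else 1 := by
    have := LinearMap.congr_fun hℓ (Basis.span D.root_indep i)
    rw [Basis.constr_basis] at this
    rw [← this, LinearMap.comp_apply, Submodule.subtype_apply, Basis.span_apply]
  exact ⟨fun hi => by rw [h1, if_pos hi], fun hi => by rw [h1, if_neg hi]⟩

/-- A linear form on weights counting the simple roots outside `Ξ`. -/
def offHeight (Ξ : Set ι) : Dual k h →ₗ[k] k := (D.exists_offHeight Ξ).choose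

theorem offHeight_root (Ξ : Set ι) (i : ι) : (i ∈ Ξ → D.offHeight Ξ (D.root i) = 0) ∧
    (i ∉ Ξ → D.offHeight Ξ (D.root i) = 1) :=
  (D.exists_offHeight Ξ).choose_spec i

theorem offHeight_posCone (Ξ : Set ι) {α : Dual k h} (hα : α ∈ D.posCone) :
    ∃ n : ℕ, D.offHeight Ξ α = n ∧ (n = 0 → α ∈ D.leviLattice Ξ) := by
  induction hα using AddSubmonoid.closure_induction with
  | mem α hα =>
    obtain ⟨i, rfl⟩ := hα
    by_cases hi : i ∈ Ξ
    · exact ⟨0, by simpa using (D.offHeight_root Ξ i).1 hi,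
        fun _ => AddSubgroup.subset_closure ⟨i, hi, rfl⟩⟩
    · exact ⟨1, by simpa using (D.offHeight_root Ξ i).2 hi, by simp⟩
  | zero => exact ⟨0, by simp, fun _ => zero_mem _⟩
  | add α β _ _ h1 h2 =>
    obtain ⟨n, hn, hn'⟩ := h1
    obtain ⟨m, hm, hm'⟩ := h2
    refine ⟨n + m, by simp [hn, hm], fun h0 => ?_⟩
    exact add_mem (hn' (by omega)) (hm' (by omega))

theorem offHeight_leviLattice (Ξ : Set ι) {α : Dual k h} (hα : α ∈ D.leviLattice Ξ) :
    D.offHeight Ξ α = 0 := by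
  have : D.leviLattice Ξ ≤ (LinearMap.ker (D.offHeight Ξ)).toAddSubgroup := by
    refine (AddSubgroup.closure_le _).2 ?_
    rintro _ ⟨i, hi, rfl⟩
    exact (D.offHeight_root Ξ i).1 hi
  exact this hα

/-- The generators `e i` (for `ε = 1`) or `f i` (for `ε = -1`). -/
def signedGen (ε : ℤˣ) (i : ι) : D.Alg c := if ε = 1 then D.e c i else D.f c i

theorem cartan_lie_signedGen (ε : ℤˣ) (t : h) (i : ι) :
    ⁅D.cartan c t, D.signedGen c ε i⁆ = (ε • D.root i) t • D.signedGen c ε i := by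
  rcases Int.units_eq_one_or ε with rfl | rfl
  · simp [signedGen, cartan_lie_e]
  · simp [signedGen, cartan_lie_f]

theorem signedGen_lie (ε : ℤˣ) (i j : ι) :
    ⁅D.signedGen c (-ε) i, D.signedGen c ε j⁆ ∈ LinearMap.range (D.cartan c) := by
  rcases Int.units_eq_one_or ε with rfl | rfl
  · simp only [signedGen, if_true]
    rw [if_neg (by decide), ← lie_skew, neg_mem_iff]
    exact D.e_lie_f c j i
  · simp only [signedGen, neg_neg, if_true]
    rw [if_neg (by decide)]
    exact D.e_lie_f c i j

/-- The subalgebra generated by the `e i` (for `ε = 1`) or by the `f i` (for `ε = -1`). -/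
def signedSpan (ε : ℤˣ) : LieSubalgebra k (D.Alg c) :=
  LieSubalgebra.lieSpan k _ (Set.range (D.signedGen c ε))

theorem signedGen_mem (ε : ℤˣ) (i : ι) : D.signedGen c ε i ∈ D.signedSpan c ε :=
  LieSubalgebra.subset_lieSpan ⟨i, rfl⟩

theorem cartan_lie_signedSpan (ε : ℤˣ) (t : h) {x : D.Alg c} (hx : x ∈ D.signedSpan c ε) :
    ⁅D.cartan c t, x⁆ ∈ D.signedSpan c ε := by
  induction hx using LieSubalgebra.lieSpan_induction with
  | mem x hx =>
    obtain ⟨i, rfl⟩ := hx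
    rw [cartan_lie_signedGen]
    exact (D.signedSpan c ε).smul_mem _ (D.signedGen_mem c ε i)
  | zero => simp
  | add x y _ _ h1 h2 => rw [lie_add]; exact add_mem h1 h2
  | smul a x _ h1 => rw [lie_smul]; exact (D.signedSpan c ε).smul_mem _ h1
  | lie x y hx hy h1 h2 =>
    rw [leibniz_lie]
    exact add_mem ((D.signedSpan c ε).lie_mem h1 hy) ((D.signedSpan c ε).lie_mem hx h2)

theorem signedGen_neg_lie_signedSpan (ε : ℤˣ) (i : ι) {x : D.Alg c} (hx : x ∈ D.signedSpan c ε) :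
    ⁅D.signedGen c (-ε) i, x⁆ ∈ LinearMap.range (D.cartan c) ⊔ (D.signedSpan c ε).toSubmodule := by
  have key : ∀ x y, x ∈ LinearMap.range (D.cartan c) ⊔ (D.signedSpan c ε).toSubmodule →
      y ∈ D.signedSpan c ε → ⁅x, y⁆ ∈ D.signedSpan c ε := by
    intro x y hx hy
    obtain ⟨_, ⟨t, rfl⟩, z, hz, rfl⟩ := Submodule.mem_sup.1 hx
    rw [add_lie]
    exact add_mem (D.cartan_lie_signedSpan c ε t hy) ((D.signedSpan c ε).lie_mem hz hy)
  induction hx using LieSubalgebra.lieSpan_induction with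
  | mem x hx =>
    obtain ⟨j, rfl⟩ := hx
    exact Submodule.mem_sup_left (D.signedGen_lie c ε i j)
  | zero => simp
  | add x y _ _ h1 h2 => rw [lie_add]; exact add_mem h1 h2
  | smul a x _ h1 => rw [lie_smul]; exact Submodule.smul_mem _ _ h1
  | lie x y hx hy h1 h2 =>
    rw [leibniz_lie, ← lie_skew x]
    refine Submodule.mem_sup_right (add_mem (key _ _ h1 hy) (neg_mem (key _ _ h2 hx)))

theorem triangular (x : D.Alg c) : x ∈ (D.signedSpan c (-1)).toSubmodule ⊔
    LinearMap.range (D.cartan c) ⊔ (D.signedSpan c 1).toSubmodule := by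
  set T := (D.signedSpan c (-1)).toSubmodule ⊔ LinearMap.range (D.cartan c) ⊔
    (D.signedSpan c 1).toSubmodule with hT
  have hspan : ∀ ε, (D.signedSpan c ε).toSubmodule ≤ T := by
    intro ε
    rcases Int.units_eq_one_or ε with rfl | rfl
    · exact le_sup_right
    · exact le_sup_left.trans le_sup_left
  have hcar : LinearMap.range (D.cartan c) ≤ T := le_sup_right.trans le_sup_left
  have hT' : ∀ ε, T ≤ (D.signedSpan c (-ε)).toSubmodule ⊔ LinearMap.range (D.cartan c) ⊔
      (D.signedSpan c ε).toSubmodule := by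
    intro ε
    rcases Int.units_eq_one_or ε with rfl | rfl
    · exact le_rfl
    · rw [hT, neg_neg, sup_comm, sup_comm _ (LinearMap.range _), sup_assoc]
  let K : LieSubalgebra k (D.Alg c) :=
    { carrier := {x | x ∈ T ∧ ∀ y ∈ T, ⁅x, y⁆ ∈ T}
      add_mem' := fun {x y} hx hy => ⟨add_mem hx.1 hy.1, fun z hz => by
        rw [add_lie]; exact add_mem (hx.2 z hz) (hy.2 z hz)⟩
      zero_mem' := ⟨zero_mem _, fun z _ => by simp⟩
      smul_mem' := fun a x hx => ⟨T.smul_mem _ hx.1, fun z hz => by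
        rw [smul_lie]; exact T.smul_mem _ (hx.2 z hz)⟩
      lie_mem' := fun {x y} hx hy => ⟨hx.2 _ hy.1, fun z hz => by
        rw [lie_lie]; exact sub_mem (hx.2 _ (hy.2 _ hz)) (hy.2 _ (hx.2 _ hz))⟩ }
  have hgen : ∀ ε i, D.signedGen c ε i ∈ K := by
    intro ε i
    refine ⟨hspan ε (D.signedGen_mem c ε i), fun y hy => ?_⟩
    obtain ⟨w, hw, z, hz, rfl⟩ := Submodule.mem_sup.1 (hT' ε hy)
    obtain ⟨u, hu, _, ⟨t, rfl⟩, rfl⟩ := Submodule.mem_sup.1 hw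
    rw [lie_add, lie_add]
    refine add_mem (add_mem ?_ ?_) ?_
    · have := D.signedGen_neg_lie_signedSpan c (-ε) i hu
      rw [neg_neg] at this
      exact sup_le hcar (hspan _) this
    · rw [← lie_skew]
      exact neg_mem (hspan ε (D.cartan_lie_signedSpan c ε t (D.signedGen_mem c ε i)))
    · exact hspan ε ((D.signedSpan c ε).lie_mem (D.signedGen_mem c ε i) hz)
  have hK : K = ⊤ := by
    refine D.eq_top_of_generators c K (fun i => ?_) (fun i => ?_) (fun t => ?_)
    · exact hgen 1 i
    · exact hgen (-1) i
    · refine ⟨hcar ⟨t, rfl⟩, fun y hy => ?_⟩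
      obtain ⟨w, hw, z, hz, rfl⟩ := Submodule.mem_sup.1 hy
      obtain ⟨u, hu, _, ⟨s, rfl⟩, rfl⟩ := Submodule.mem_sup.1 hw
      rw [lie_add, lie_add, cartan_lie_cartan, add_zero]
      exact add_mem (hspan _ (D.cartan_lie_signedSpan c _ t hu))
        (hspan _ (D.cartan_lie_signedSpan c _ t hz))
  have : x ∈ K := hK ▸ LieSubalgebra.mem_top x
  exact this.1

/-- The non-zero elements of `Q₊` up to the sign `ε`. -/
def signedCone (ε : ℤˣ) : Set (Dual k h) :=
  {α | ε • α ∈ D.posCone ∧ ∃ n : ℕ, D.offHeight ∅ (ε • α) = n + 1}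

theorem signedSpan_le (ε : ℤˣ) :
    (D.signedSpan c ε).toSubmodule ≤ ⨆ α ∈ D.signedCone ε, D.rootSpace c α := by
  intro x hx
  replace hx : x ∈ D.signedSpan c ε := hx
  induction hx using LieSubalgebra.lieSpan_induction with
  | mem x hx =>
    obtain ⟨i, rfl⟩ := hx
    refine Submodule.mem_iSup_of_mem (ε • D.root i) (Submodule.mem_iSup_of_mem ?_
      fun t => D.cartan_lie_signedGen c ε t i)
    have h1 : ε • ε • D.root i = D.root i := by rw [smul_smul, Int.units_mul_self, one_smul]
    refine ⟨by rw [h1]; exact AddSubmonoid.subset_closure ⟨i, rfl⟩, 0, ?_⟩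
    rw [h1]
    simpa using (D.offHeight_root ∅ i).2 (Set.notMem_empty i)
  | zero => simp
  | add x y _ _ h1 h2 => exact add_mem h1 h2
  | smul a x _ h1 => exact Submodule.smul_mem _ _ h1
  | lie x y hx hy h1 h2 =>
    clear hx hy
    have step : ∀ α ∈ D.signedCone ε, ∀ x ∈ D.rootSpace c α,
        ⁅x, y⁆ ∈ ⨆ α ∈ D.signedCone ε, D.rootSpace c α := by
      intro α hα x hx
      induction h2 using Submodule.iSup_induction' with
      | mem β y hy =>
        induction hy using Submodule.iSup_induction' with
        | mem hβ y hy =>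
          refine Submodule.mem_iSup_of_mem (α + β) (Submodule.mem_iSup_of_mem ?_
            (D.lie_mem_rootSpace c hx hy))
          obtain ⟨h1, n, hn⟩ := hα
          obtain ⟨h2, m, hm⟩ := hβ
          refine ⟨by rw [smul_add]; exact add_mem h1 h2, n + m + 1, ?_⟩
          rw [smul_add, map_add, hn, hm]
          push_cast
          ring
        | zero => simp
        | add y z _ _ h1 h2 => rw [lie_add]; exact add_mem h1 h2
      | zero => simp
      | add y z _ _ h1 h2 => rw [lie_add]; exact add_mem h1 h2
    induction h1 using Submodule.iSup_induction' with
    | mem α x hx =>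
      induction hx using Submodule.iSup_induction' with
      | mem hα x hx => exact step α hα x hx
      | zero => simp
      | add y z _ _ h1 h2 => rw [add_lie]; exact add_mem h1 h2
    | zero => simp
    | add y z _ _ h1 h2 => rw [add_lie]; exact add_mem h1 h2

theorem cartan_mem_rootSpace (t : h) : D.cartan c t ∈ D.rootSpace c 0 := by
  intro s
  rw [cartan_lie_cartan]
  simp

theorem mem_triangular (x : D.Alg c) : x ∈ LinearMap.range (D.cartan c) ⊔
    ⨆ α ∈ D.signedCone (-1) ∪ D.signedCone 1, D.rootSpace c α := by
  have : (D.signedSpan c (-1)).toSubmodule ⊔ LinearMap.range (D.cartan c) ⊔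
      (D.signedSpan c 1).toSubmodule ≤ LinearMap.range (D.cartan c) ⊔
        ⨆ α ∈ D.signedCone (-1) ∪ D.signedCone 1, D.rootSpace c α := by
    refine sup_le (sup_le ?_ le_sup_left) ?_
    · exact (D.signedSpan_le c _).trans
        ((biSup_mono fun α h => Or.inl h).trans le_sup_right)
    · exact (D.signedSpan_le c _).trans
        ((biSup_mono fun α h => Or.inr h).trans le_sup_right)
  exact this (D.triangular c x)

variable [CharZero k]

theorem zero_notMem_signedCone (ε : ℤˣ) : (0 : Dual k h) ∉ D.signedCone ε := by
  rintro ⟨-, n, hn⟩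
  rw [smul_zero, map_zero] at hn
  exact Nat.cast_add_one_ne_zero n hn.symm

theorem rootSpace_zero : D.rootSpace c 0 = LinearMap.range (D.cartan c) := by
  refine le_antisymm (fun x hx => ?_) ?_
  · obtain ⟨_, ⟨t, rfl⟩, y, hy, rfl⟩ := Submodule.mem_sup.1 (D.mem_triangular c x)
    have h1 : y ∈ D.rootSpace c 0 := by
      simpa using sub_mem hx (D.cartan_mem_rootSpace c t)
    have h2 : (0 : Dual k h) ∉ D.signedCone (-1) ∪ D.signedCone 1 := by
      rintro (h | h) <;> exact D.zero_notMem_signedCone _ h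
    have h3 := Submodule.disjoint_def.1 ((D.iSupIndep_rootSpace c).disjoint_biSup h2) y h1 hy
    rw [h3, add_zero]
    exact ⟨t, rfl⟩
  · rintro _ ⟨t, rfl⟩
    exact D.cartan_mem_rootSpace c t

theorem iSup_rootSpace : ⨆ α, D.rootSpace c α = ⊤ := by
  refine eq_top_iff.2 fun x _ => ?_
  refine (sup_le ?_ ?_ : _ ≤ (_ : Submodule k (D.Alg c))) (D.mem_triangular c x)
  · rw [← rootSpace_zero]; exact le_iSup _ _
  · exact iSup₂_le fun α _ => le_iSup _ _

theorem root_sign {α : Dual k h} (hα : α ∈ D.roots c) :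
    α ∈ D.signedRoots c 1 ∨ α ∈ D.signedRoots c (-1) := by
  by_contra hcon
  push Not at hcon
  have h2 : α ∉ D.signedCone (-1) ∪ D.signedCone 1 ∪ {0} := by
    rintro ((h | h) | h)
    · exact hcon.2 ⟨hα, h.1⟩
    · exact hcon.1 ⟨hα, h.1⟩
    · exact hα.1 h
  refine hα.2 (eq_bot_iff.2 fun x hx => ?_)
  refine Submodule.disjoint_def.1 ((D.iSupIndep_rootSpace c).disjoint_biSup h2) x hx ?_
  refine (sup_le ?_ ?_ : _ ≤ (_ : Submodule k (D.Alg c))) (D.mem_triangular c x)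
  · rw [← rootSpace_zero]
    exact le_biSup _ (Or.inr rfl)
  · exact biSup_mono fun α h => Or.inl h

end Structure

section Parabolic

variable (ε : ℤˣ) (Ξ : Set ι)

/-- The weights whose `offHeight` is an integer in `S`. -/
def gradedSet (S : Set ℤ) : Set (Dual k h) := {α | ∃ z ∈ S, D.offHeight Ξ (ε • α) = ((z : ℤ) : k)}

/-- The sum of the weight spaces whose `offHeight` is an integer in `S`. -/
def gradedPart (S : Set ℤ) : Submodule k (D.Alg c) :=
  ⨆ α ∈ D.gradedSet ε Ξ S, D.rootSpace c α

theorem lie_mem_gradedPart {S S' S'' : Set ℤ} (hS : ∀ a ∈ S, ∀ b ∈ S', a + b ∈ S'')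
    {x y : D.Alg c} (hx : x ∈ D.gradedPart c ε Ξ S) (hy : y ∈ D.gradedPart c ε Ξ S') :
    ⁅x, y⁆ ∈ D.gradedPart c ε Ξ S'' := by
  have step : ∀ α ∈ D.gradedSet ε Ξ S, ∀ x ∈ D.rootSpace c α,
      ⁅x, y⁆ ∈ D.gradedPart c ε Ξ S'' := by
    intro α hα x hx
    rw [gradedPart] at hy
    induction hy using Submodule.iSup_induction' with
    | mem β y hy =>
      induction hy using Submodule.iSup_induction' with
      | mem hβ y hy =>
        refine Submodule.mem_iSup_of_mem (α + β) (Submodule.mem_iSup_of_mem ?_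
          (D.lie_mem_rootSpace c hx hy))
        obtain ⟨a, ha, hn⟩ := hα
        obtain ⟨b, hb, hm⟩ := hβ
        refine ⟨a + b, hS a ha b hb, ?_⟩
        rw [smul_add, map_add, hn, hm]
        push_cast
        rfl
      | zero => simp
      | add y z _ _ h1 h2 => rw [lie_add]; exact add_mem h1 h2
    | zero => simp
    | add y z _ _ h1 h2 => rw [lie_add]; exact add_mem h1 h2
  rw [gradedPart] at hx
  induction hx using Submodule.iSup_induction' with
  | mem α x hx =>
    induction hx using Submodule.iSup_induction' with
    | mem hα x hx => exact step α hα x hx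
    | zero => simp
    | add y z _ _ h1 h2 => rw [add_lie]; exact add_mem h1 h2
  | zero => simp
  | add y z _ _ h1 h2 => rw [add_lie]; exact add_mem h1 h2

theorem rootSpace_le_gradedPart {S : Set ℤ} {α : Dual k h} {z : ℤ} (hz : z ∈ S)
    (hα : D.offHeight Ξ (ε • α) = z) : D.rootSpace c α ≤ D.gradedPart c ε Ξ S :=
  le_biSup (D.rootSpace c) (show α ∈ D.gradedSet ε Ξ S from ⟨z, hz, hα⟩)

variable [CharZero k]

theorem offHeight_signedRoots {α : Dual k h} (hα : α ∈ D.signedRoots c ε) :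
    ∃ n : ℕ, D.offHeight Ξ (ε • α) = n ∧ (n = 0 ↔ α ∈ D.leviRoots c Ξ) := by
  obtain ⟨n, hn, hn'⟩ := D.offHeight_posCone Ξ hα.2
  have hε : ε • α ∈ D.leviLattice Ξ ↔ α ∈ D.leviLattice Ξ := by
    rcases Int.units_eq_one_or ε with rfl | rfl <;> simp
  refine ⟨n, hn, fun h0 => ⟨hα.1, hε.1 (hn' h0)⟩, fun hl => ?_⟩
  rw [D.offHeight_leviLattice Ξ (hε.2 hl.2)] at hn
  exact_mod_cast hn.symm

theorem root_sign' {α : Dual k h} (hα : α ∈ D.roots c) :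
    α ∈ D.signedRoots c ε ∨ α ∈ D.signedRoots c (-ε) := by
  rcases Int.units_eq_one_or ε with rfl | rfl
  · exact D.root_sign c hα
  · rw [neg_neg]; exact (D.root_sign c hα).symm

/-- The integer grading of a root, by the number of simple roots outside `Ξ`. -/
theorem root_cases {α : Dual k h} (hα : α ∈ D.roots c) : ∃ z : ℤ, D.offHeight Ξ (ε • α) = z ∧
    (0 < z ↔ α ∈ D.signedRoots c ε \ D.leviRoots c Ξ) ∧
    (z < 0 ↔ α ∈ D.signedRoots c (-ε) \ D.leviRoots c Ξ) ∧
    (z = 0 ↔ α ∈ D.leviRoots c Ξ) := by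
  have h1 : ∀ α ∈ D.signedRoots c ε, ∀ z : ℤ, D.offHeight Ξ (ε • α) = z →
      0 ≤ z ∧ (z = 0 ↔ α ∈ D.leviRoots c Ξ) := by
    intro α hα z hz
    obtain ⟨n, hn, hn'⟩ := D.offHeight_signedRoots c ε Ξ hα
    have : z = n := by rw [hn] at hz; exact_mod_cast hz.symm
    subst this
    exact ⟨by simp, by rw [← hn']; simp⟩
  have h2 : ∀ α ∈ D.signedRoots c (-ε), ∀ z : ℤ, D.offHeight Ξ (ε • α) = z →
      z ≤ 0 ∧ (z = 0 ↔ α ∈ D.leviRoots c Ξ) := by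
    intro α hα z hz
    obtain ⟨n, hn, hn'⟩ := D.offHeight_signedRoots c (-ε) Ξ hα
    have : z = -n := by
      rw [Units.neg_smul, map_neg, hz, neg_eq_iff_eq_neg] at hn
      exact_mod_cast hn
    subst this
    exact ⟨by simp, by rw [← hn']; simp⟩
  obtain ⟨z, hz⟩ : ∃ z : ℤ, D.offHeight Ξ (ε • α) = z := by
    rcases D.root_sign' c ε hα with h | h
    · obtain ⟨n, hn, -⟩ := D.offHeight_signedRoots c ε Ξ h
      exact ⟨n, by simpa using hn⟩
    · obtain ⟨n, hn, -⟩ := D.offHeight_signedRoots c (-ε) Ξ h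
      refine ⟨-n, ?_⟩
      rw [Units.neg_smul, map_neg, neg_eq_iff_eq_neg] at hn
      simpa using hn
  refine ⟨z, hz, ⟨fun hp => ?_, fun hp => ?_⟩, ⟨fun hp => ?_, fun hp => ?_⟩, ?_⟩
  · have h3 : α ∈ D.signedRoots c ε := (D.root_sign' c ε hα).resolve_right fun h => by
      have := (h2 α h z hz).1; omega
    exact ⟨h3, fun hl => by have := (h1 α h3 z hz).2.2 hl; omega⟩
  · have := h1 α hp.1 z hz
    exact lt_of_le_of_ne this.1 fun h0 => hp.2 (this.2.1 h0.symm)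
  · have h3 : α ∈ D.signedRoots c (-ε) := (D.root_sign' c ε hα).resolve_left fun h => by
      have := (h1 α h z hz).1; omega
    exact ⟨h3, fun hl => by have := (h2 α h3 z hz).2.2 hl; omega⟩
  · have := h2 α hp.1 z hz
    exact lt_of_le_of_ne this.1 fun h0 => hp.2 (this.2.1 h0)
  · rcases D.root_sign' c ε hα with h | h
    · exact (h1 α h z hz).2
    · exact (h2 α h z hz).2

/-- A weight space contributes to the graded part only if the weight is zero or a root. -/
theorem gradedPart_le {S : Set ℤ} {U : Submodule k (D.Alg c)}
    (h0 : 0 ∈ S → LinearMap.range (D.cartan c) ≤ U)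
    (hr : ∀ α ∈ D.roots c, ∀ z ∈ S, D.offHeight Ξ (ε • α) = ((z : ℤ) : k) → D.rootSpace c α ≤ U) :
    D.gradedPart c ε Ξ S ≤ U := by
  refine iSup₂_le fun α ⟨z, hz, hα⟩ => ?_
  by_cases hα0 : α = 0
  · subst hα0
    rw [smul_zero, map_zero] at hα
    have : z = 0 := by exact_mod_cast hα.symm
    subst this
    rw [rootSpace_zero]
    exact h0 hz
  · by_cases hb : D.rootSpace c α = ⊥
    · rw [hb]; exact bot_le
    · exact hr α ⟨hα0, hb⟩ z hz hα

theorem cartan_le_gradedPart {S : Set ℤ} (hS : 0 ∈ S) :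
    LinearMap.range (D.cartan c) ≤ D.gradedPart c ε Ξ S := by
  rw [← rootSpace_zero]
  exact D.rootSpace_le_gradedPart c ε Ξ hS (by simp)

theorem leviSpace_eq : D.leviSpace c Ξ = D.gradedPart c ε Ξ {0} := by
  refine le_antisymm (sup_le (D.cartan_le_gradedPart c ε Ξ rfl) (iSup₂_le fun α hα => ?_))
    (D.gradedPart_le c ε Ξ (fun _ => le_sup_left) fun α hα z hz hα' => ?_)
  · obtain ⟨z, hz, -, -, h0⟩ := D.root_cases c ε Ξ hα.1
    exact D.rootSpace_le_gradedPart c ε Ξ (h0.2 hα) hz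
  · obtain ⟨w, hw, -, -, h0⟩ := D.root_cases c ε Ξ hα
    rw [hw] at hα'
    have : w = 0 := by rw [← show z = 0 from hz]; exact_mod_cast hα'
    exact (le_biSup (D.rootSpace c) (h0.1 this)).trans le_sup_right

theorem nilradical_eq : D.nilradical c ε Ξ = D.gradedPart c ε Ξ {z | 0 < z} := by
  refine le_antisymm (iSup₂_le fun α hα => ?_)
    (D.gradedPart_le c ε Ξ (fun h0 => (lt_irrefl (0 : ℤ) h0).elim) fun α hα z hz hα' => ?_)
  · obtain ⟨z, hz, h0, -, -⟩ := D.root_cases c ε Ξ hα.1.1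
    exact D.rootSpace_le_gradedPart c ε Ξ (h0.2 hα) hz
  · obtain ⟨w, hw, h0, -, -⟩ := D.root_cases c ε Ξ hα
    rw [hw] at hα'
    have : w = z := by exact_mod_cast hα'
    subst this
    exact le_biSup (D.rootSpace c) (h0.1 hz)

theorem nilradical_neg_eq : D.nilradical c (-ε) Ξ = D.gradedPart c ε Ξ {z | z < 0} := by
  refine le_antisymm (iSup₂_le fun α hα => ?_)
    (D.gradedPart_le c ε Ξ (fun h0 => (lt_irrefl (0 : ℤ) h0).elim) fun α hα z hz hα' => ?_)
  · obtain ⟨z, hz, -, h0, -⟩ := D.root_cases c ε Ξ hα.1.1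
    exact D.rootSpace_le_gradedPart c ε Ξ (h0.2 hα) hz
  · obtain ⟨w, hw, -, h0, -⟩ := D.root_cases c ε Ξ hα
    rw [hw] at hα'
    have : w = z := by exact_mod_cast hα'
    subst this
    exact le_biSup (D.rootSpace c) (h0.1 hz)

theorem parabolicSpace_eq : D.parabolicSpace c ε Ξ = D.gradedPart c ε Ξ {z | 0 ≤ z} := by
  refine le_antisymm (sup_le (sup_le (iSup₂_le fun α hα => ?_)
      (D.cartan_le_gradedPart c ε Ξ (le_refl (0 : ℤ)))) (iSup₂_le fun α hα => ?_))
    (D.gradedPart_le c ε Ξ (fun _ => le_sup_right.trans le_sup_left) fun α hα z hz hα' => ?_)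
  · obtain ⟨z, hz, -, -, h0⟩ := D.root_cases c ε Ξ hα.1.1
    exact D.rootSpace_le_gradedPart c ε Ξ (h0.2 hα.1).ge hz
  · obtain ⟨n, hn, -⟩ := D.offHeight_signedRoots c ε Ξ hα
    exact D.rootSpace_le_gradedPart c ε Ξ (z := n) (Int.natCast_nonneg n) (by simpa using hn)
  · obtain ⟨w, hw, h0, -, h2⟩ := D.root_cases c ε Ξ hα
    rw [hw] at hα'
    have : w = z := by exact_mod_cast hα'
    subst this
    rcases D.root_sign' c ε hα with h | h
    · exact (le_biSup (D.rootSpace c) h).trans le_sup_right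
    · rcases (show (0 : ℤ) ≤ w from hz).eq_or_lt with h3 | h3
      · exact (le_biSup (D.rootSpace c) (show α ∈ D.leviRoots c Ξ ∩ D.signedRoots c (-ε) from
          ⟨h2.1 h3.symm, h⟩)).trans (le_sup_left.trans le_sup_left)
      · exact (le_biSup (D.rootSpace c) (h0.1 h3).1).trans le_sup_right

/-- The Levi subalgebra `l_Ξ`. -/
def levi : LieSubalgebra k (D.Alg c) :=
  { D.leviSpace c Ξ with
    lie_mem' := fun {x y} hx hy => by
      change _ ∈ D.leviSpace c Ξ at hx hy
      change _ ∈ D.leviSpace c Ξ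
      rw [D.leviSpace_eq c 1 Ξ] at hx hy ⊢
      exact D.lie_mem_gradedPart c 1 Ξ (by rintro _ rfl _ rfl; rfl) hx hy }

/-- The standard parabolic subalgebra `p⁺_Ξ` (for `ε = 1`) and the opposite one `p⁻_Ξ`
(for `ε = -1`). -/
def parabolic : LieSubalgebra k (D.Alg c) :=
  { D.parabolicSpace c ε Ξ with
    lie_mem' := fun {x y} hx hy => by
      change _ ∈ D.parabolicSpace c ε Ξ at hx hy
      change _ ∈ D.parabolicSpace c ε Ξ
      rw [D.parabolicSpace_eq c ε Ξ] at hx hy ⊢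
      exact D.lie_mem_gradedPart c ε Ξ (fun _ ha _ hb => add_nonneg ha hb) hx hy }

theorem isCompl_levi :
    IsCompl (D.leviSpace c Ξ) (D.nilradical c ε Ξ ⊔ D.nilradical c (-ε) Ξ) := by
  constructor
  · rw [D.leviSpace_eq c ε, D.nilradical_eq, D.nilradical_neg_eq]
    have hd : Disjoint (D.gradedSet ε Ξ {0}) (D.gradedSet ε Ξ {z | 0 < z} ∪
        D.gradedSet ε Ξ {z | z < 0}) := by
      rw [Set.disjoint_left]
      rintro α ⟨a, ha, h1⟩ (⟨b, hb, h2⟩ | ⟨b, hb, h2⟩)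
      · rw [h1] at h2
        have : a = b := by exact_mod_cast h2
        subst this
        exact absurd (show a = 0 from ha) (ne_of_gt hb)
      · rw [h1] at h2
        have : a = b := by exact_mod_cast h2
        subst this
        exact absurd (show a = 0 from ha) (ne_of_lt hb)
    have := (D.iSupIndep_rootSpace c).disjoint_biSup_biSup hd
    rwa [iSup_union] at this
  · rw [codisjoint_iff, eq_top_iff, ← D.iSup_rootSpace c]
    refine iSup_le fun α => ?_
    by_cases hα0 : α = 0
    · subst hα0
      rw [rootSpace_zero]
      exact le_sup_left.trans le_sup_left
    by_cases hb : D.rootSpace c α = ⊥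
    · rw [hb]; exact bot_le
    obtain ⟨z, -, h1, h2, h3⟩ := D.root_cases c ε Ξ (α := α) ⟨hα0, hb⟩
    rcases lt_trichotomy z 0 with hz | hz | hz
    · exact (le_biSup (D.rootSpace c) (h2.1 hz)).trans (le_sup_right.trans le_sup_right)
    · exact (le_biSup (D.rootSpace c) (h3.1 hz)).trans (le_sup_right.trans le_sup_left)
    · exact (le_biSup (D.rootSpace c) (h1.1 hz)).trans (le_sup_left.trans le_sup_right)

/-- The linear projection of `g = l_Ξ ⊕ (u⁺_Ξ ⊕ u⁻_Ξ)` onto `l_Ξ`. -/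
def leviProj : D.Alg c →ₗ[k] D.leviSpace c Ξ :=
  Submodule.projectionOnto (D.leviSpace c Ξ) (D.nilradical c 1 Ξ ⊔ D.nilradical c (-1) Ξ)
    (D.isCompl_levi c 1 Ξ)

theorem leviProj_levi {x : D.Alg c} (hx : x ∈ D.leviSpace c Ξ) :
    (D.leviProj c Ξ x : D.Alg c) = x := by
  have := Submodule.projectionOnto_apply_left (D.isCompl_levi c 1 Ξ) ⟨x, hx⟩
  exact congrArg Subtype.val this

theorem leviProj_nilradical {x : D.Alg c} (hx : x ∈ D.nilradical c ε Ξ) :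
    D.leviProj c Ξ x = 0 := by
  refine (Submodule.projectionOnto_apply_eq_zero_iff (D.isCompl_levi c 1 Ξ)).2 ?_
  rcases Int.units_eq_one_or ε with rfl | rfl
  · exact Submodule.mem_sup_left hx
  · exact Submodule.mem_sup_right hx

theorem exists_levi_add_nilradical {x : D.Alg c} (hx : x ∈ D.parabolicSpace c ε Ξ) :
    ∃ y ∈ D.leviSpace c Ξ, ∃ z ∈ D.nilradical c ε Ξ, x = y + z := by
  have hle : D.parabolicSpace c ε Ξ ≤ D.leviSpace c Ξ ⊔ D.nilradical c ε Ξ := by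
    rw [parabolicSpace_eq, D.leviSpace_eq c ε, nilradical_eq]
    refine iSup₂_le fun α ⟨z, hz, hα⟩ => ?_
    rcases (show (0 : ℤ) ≤ z from hz).eq_or_lt with h | h
    · exact (D.rootSpace_le_gradedPart c ε Ξ (S := {0}) h.symm hα).trans le_sup_left
    · exact (D.rootSpace_le_gradedPart c ε Ξ (S := {z | 0 < z}) h hα).trans le_sup_right
  obtain ⟨y, hy, z, hz, rfl⟩ := Submodule.mem_sup.1 (hle hx)
  exact ⟨y, hy, z, hz, rfl⟩

/-- The projection `p^±_Ξ ↠ l_Ξ` of Lie algebras, with kernel `u^±_Ξ`. -/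
def toLevi : D.parabolic c ε Ξ →ₗ⁅k⁆ D.levi c Ξ :=
  { (D.leviProj c Ξ) ∘ₗ (D.parabolic c ε Ξ).toSubmodule.subtype with
    map_lie' := fun {x y} => by
      obtain ⟨x, hx⟩ := x
      obtain ⟨y, hy⟩ := y
      obtain ⟨a, ha, u, hu, rfl⟩ := D.exists_levi_add_nilradical c ε Ξ hx
      obtain ⟨b, hb, v, hv, rfl⟩ := D.exists_levi_add_nilradical c ε Ξ hy
      have e1 : ∀ a u, a ∈ D.leviSpace c Ξ → u ∈ D.nilradical c ε Ξ →
          (D.leviProj c Ξ (a + u) : D.Alg c) = a := by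
        intro a u ha hu
        rw [map_add, D.leviProj_nilradical c ε Ξ hu, add_zero, leviProj_levi D c Ξ ha]
      have hab : ⁅a, b⁆ ∈ D.leviSpace c Ξ := (D.levi c Ξ).lie_mem ha hb
      have hn : ⁅a, v⁆ + ⁅u, b⁆ + ⁅u, v⁆ ∈ D.nilradical c ε Ξ := by
        rw [nilradical_eq] at hu hv ⊢
        rw [D.leviSpace_eq c ε] at ha hb
        refine add_mem (add_mem ?_ ?_) ?_
        · exact D.lie_mem_gradedPart c ε Ξ
            (by rintro _ rfl b hb; simpa using hb) ha hv
        · exact D.lie_mem_gradedPart c ε Ξ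
            (by rintro a ha _ rfl; simpa using ha) hu hb
        · exact D.lie_mem_gradedPart c ε Ξ (fun _ ha _ hb => add_pos ha hb) hu hv
      refine Subtype.ext ?_
      change (D.leviProj c Ξ ⁅a + u, b + v⁆ : D.Alg c) =
        ⁅(D.leviProj c Ξ (a + u) : D.Alg c), (D.leviProj c Ξ (b + v) : D.Alg c)⁆
      rw [e1 a u ha hu, e1 b v hb hv, ← e1 ⁅a, b⁆ _ hab hn, add_lie, lie_add, lie_add]
      congr 2
      abel }

/-- The inclusion of the Cartan subalgebra into the Levi subalgebra. -/
def cartanLevi : h →ₗ[k] D.levi c Ξ :=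
  (D.cartan c).codRestrict (D.levi c Ξ).toSubmodule fun t => Submodule.mem_sup_left ⟨t, rfl⟩

end Parabolic

section Modules

variable [CharZero k] (ε : ℤˣ) (Ξ : Set ι)

/-- The inclusion `U(p^±_Ξ) → U(g)`. -/
def parabolicIncl : UniversalEnvelopingAlgebra k (D.parabolic c ε Ξ) →ₐ[k]
    UniversalEnvelopingAlgebra k (D.Alg c) :=
  UniversalEnvelopingAlgebra.lift k
    ((UniversalEnvelopingAlgebra.ι k).comp (D.parabolic c ε Ξ).incl)

variable (N : Type*) [AddCommGroup N] [Module k N] [LieRingModule (D.levi c Ξ) N]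
  [LieModule k (D.levi c Ξ) N]

/-- The action of `U(p^±_Ξ)` on an `l_Ξ`-module `N` inflated along `p^±_Ξ ↠ l_Ξ`. -/
def inflate : UniversalEnvelopingAlgebra k (D.parabolic c ε Ξ) →ₐ[k] Module.End k N :=
  UniversalEnvelopingAlgebra.lift k ((LieModule.toEnd k (D.levi c Ξ) N).comp (D.toLevi c ε Ξ))

/-- The relations `X Y ⊗ n = X ⊗ Y n`, for `Y ∈ U(p⁺_Ξ)`, defining the tensor product over
`U(p⁺_Ξ)`, as a (left) `U(g)`-submodule of `U(g) ⊗ N`. -/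
def indShriekRel : Submodule (UniversalEnvelopingAlgebra k (D.Alg c))
    (UniversalEnvelopingAlgebra k (D.Alg c) ⊗[k] N) :=
  Submodule.span _ {v | ∃ X Y n, v = (X * D.parabolicIncl c 1 Ξ Y) ⊗ₜ[k] n -
    X ⊗ₜ[k] (D.inflate c 1 Ξ N Y n)}

/-- The parabolic `!`-induction `Ind_{Ξ,!}(N) = U(g) ⊗_{U(p⁺_Ξ)} N`. -/
def IndShriek : Type _ :=
  (UniversalEnvelopingAlgebra k (D.Alg c) ⊗[k] N) ⧸ D.indShriekRel c Ξ N

instance : AddCommGroup (D.IndShriek c Ξ N) :=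
  inferInstanceAs (AddCommGroup ((UniversalEnvelopingAlgebra k (D.Alg c) ⊗[k] N) ⧸
    D.indShriekRel c Ξ N))

instance : Module (UniversalEnvelopingAlgebra k (D.Alg c)) (D.IndShriek c Ξ N) :=
  inferInstanceAs (Module (UniversalEnvelopingAlgebra k (D.Alg c))
    ((UniversalEnvelopingAlgebra k (D.Alg c) ⊗[k] N) ⧸ D.indShriekRel c Ξ N))

instance : Module k (D.IndShriek c Ξ N) :=
  inferInstanceAs (Module k ((UniversalEnvelopingAlgebra k (D.Alg c) ⊗[k] N) ⧸
    D.indShriekRel c Ξ N))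

instance : IsScalarTower k (UniversalEnvelopingAlgebra k (D.Alg c)) (D.IndShriek c Ξ N) :=
  inferInstanceAs (IsScalarTower k (UniversalEnvelopingAlgebra k (D.Alg c))
    ((UniversalEnvelopingAlgebra k (D.Alg c) ⊗[k] N) ⧸ D.indShriekRel c Ξ N))

/-- The Lie algebra `g` acts on `Ind_{Ξ,!}(N)` by left multiplication. -/
instance : LieRingModule (D.Alg c) (D.IndShriek c Ξ N) where
  bracket x v := UniversalEnvelopingAlgebra.ι k x • v
  add_lie x y v := by
    change UniversalEnvelopingAlgebra.ι k (x + y) • v = _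
    rw [map_add, add_smul]
  lie_add x v w := smul_add (UniversalEnvelopingAlgebra.ι k x) v w
  leibniz_lie x y v := by
    change UniversalEnvelopingAlgebra.ι k x • UniversalEnvelopingAlgebra.ι k y • v =
      UniversalEnvelopingAlgebra.ι k ⁅x, y⁆ • v +
        UniversalEnvelopingAlgebra.ι k y • UniversalEnvelopingAlgebra.ι k x • v
    rw [LieHom.map_lie, LieRing.of_associative_ring_bracket, sub_smul, mul_smul, mul_smul,
      sub_add_cancel]

instance : LieModule k (D.Alg c) (D.IndShriek c Ξ N) where
  smul_lie a x v := by
    change UniversalEnvelopingAlgebra.ι k (a • x) • v = a • UniversalEnvelopingAlgebra.ι k x • v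
    rw [map_smul, smul_assoc]
  lie_smul a x v := by
    change UniversalEnvelopingAlgebra.ι k x • a • v = a • UniversalEnvelopingAlgebra.ι k x • v
    rw [smul_comm]

/-- The map `n ↦ 1 ⊗ n` from `N` to `Ind_{Ξ,!}(N)`. -/
def oneTensor : N →ₗ[k] D.IndShriek c Ξ N :=
  ((D.indShriekRel c Ξ N).mkQ.restrictScalars k) ∘ₗ
    TensorProduct.mk k (UniversalEnvelopingAlgebra k (D.Alg c)) N 1

/-- The parabolic `*`-induction (coinduction) `Ind_{Ξ,*}(N) = Hom_{U(p⁻_Ξ)}(U(g), N)`. Here `U(g)`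
is a left `U(p⁻_Ξ)`-module by `Y • X = X τ(Y)` and a right `U(g)`-module by `X • Z = τ(Z) X`. -/
def indStarSpace : Submodule k (UniversalEnvelopingAlgebra k (D.Alg c) →ₗ[k] N) where
  carrier := {φ | ∀ Y X, φ (X * D.τ c (D.parabolicIncl c (-1) Ξ Y)) = D.inflate c (-1) Ξ N Y (φ X)}
  add_mem' {φ ψ} hφ hψ Y X := by simp [hφ Y X, hψ Y X]
  zero_mem' Y X := by simp
  smul_mem' a φ hφ Y X := by simp [hφ Y X]

/-- The parabolic `*`-induction, as a type. -/
def IndStar : Type _ := D.indStarSpace c Ξ N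

instance : AddCommGroup (D.IndStar c Ξ N) := inferInstanceAs (AddCommGroup (D.indStarSpace c Ξ N))

instance : Module k (D.IndStar c Ξ N) := inferInstanceAs (Module k (D.indStarSpace c Ξ N))

/-- The function on `U(g)` underlying an element of `Ind_{Ξ,*}(N)`. -/
def IndStar.toFun : D.IndStar c Ξ N →ₗ[k] (UniversalEnvelopingAlgebra k (D.Alg c) →ₗ[k] N) :=
  (D.indStarSpace c Ξ N).subtype

/-- The action `(x φ)(X) = φ(τ(x) X)` of `g` on `Ind_{Ξ,*}(N)`. -/
def indStarAct (x : D.Alg c) (φ : D.IndStar c Ξ N) : D.IndStar c Ξ N :=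
  ⟨IndStar.toFun D c Ξ N φ ∘ₗ
      LinearMap.mulLeft k (UniversalEnvelopingAlgebra.ι k (D.transpose c x)), fun Y X => by
    have := φ.2 Y (UniversalEnvelopingAlgebra.ι k (D.transpose c x) * X)
    rw [mul_assoc] at this
    exact this⟩

theorem indStarAct_apply (x : D.Alg c) (φ : D.IndStar c Ξ N)
    (X : UniversalEnvelopingAlgebra k (D.Alg c)) :
    IndStar.toFun D c Ξ N (D.indStarAct c Ξ N x φ) X =
      IndStar.toFun D c Ξ N φ (UniversalEnvelopingAlgebra.ι k (D.transpose c x) * X) := rfl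

theorem IndStar.ext {φ ψ : D.IndStar c Ξ N}
    (hφ : ∀ X, IndStar.toFun D c Ξ N φ X = IndStar.toFun D c Ξ N ψ X) : φ = ψ :=
  Subtype.ext (LinearMap.ext hφ)

instance : LieRingModule (D.Alg c) (D.IndStar c Ξ N) where
  bracket := D.indStarAct c Ξ N
  add_lie x y φ := IndStar.ext D c Ξ N fun X => by
    simp [indStarAct_apply, add_mul]
  lie_add x φ ψ := IndStar.ext D c Ξ N fun X => by
    simp [indStarAct_apply]
  leibniz_lie x y φ := IndStar.ext D c Ξ N fun X => by
    simp [indStarAct_apply, transpose_lie, LieRing.of_associative_ring_bracket, sub_mul, mul_assoc]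

instance : LieModule k (D.Alg c) (D.IndStar c Ξ N) where
  smul_lie a x φ := IndStar.ext D c Ξ N fun X => by
    change IndStar.toFun D c Ξ N (D.indStarAct c Ξ N _ _) X = IndStar.toFun D c Ξ N
      (a • D.indStarAct c Ξ N _ _) X
    simp [indStarAct_apply]
  lie_smul a x φ := IndStar.ext D c Ξ N fun X => by
    change IndStar.toFun D c Ξ N (D.indStarAct c Ξ N _ _) X = IndStar.toFun D c Ξ N
      (a • D.indStarAct c Ξ N _ _) X
    simp [indStarAct_apply]

/-- The natural map `Ind_{Ξ,!}(N) → Ind_{Ξ,*}(N)` is the homomorphism of `g`-modules that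
corresponds to the identity of `N` under
`Hom_g(Ind_{Ξ,!} N, Ind_{Ξ,*} N) = Hom_{l_Ξ}(N, Res^!_Ξ Ind_{Ξ,*} N) = Hom_{l_Ξ}(N, N)`, where
`Res^!_Ξ Ind_{Ξ,*} N = N` is the evaluation at `1`: it is the `Φ` with `Φ(1 ⊗ n)(1) = n`. -/
def IsNaturalMap (Φ : D.IndShriek c Ξ N →ₗ⁅k, D.Alg c⁆ D.IndStar c Ξ N) : Prop :=
  ∀ n : N, IndStar.toFun D c Ξ N (Φ (D.oneTensor c Ξ N n)) 1 = n

end Modules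

section Weight

variable {M : Type*} [AddCommGroup M] [Module k M]

/-- The weight space `M_λ = {v | t v = λ(t) v for all t ∈ h}` for an action of `h` on `M`. -/
def weightSpace (a : h →ₗ[k] Module.End k M) (wt : Dual k h) : Submodule k M where
  carrier := {v | ∀ t : h, a t v = wt t • v}
  add_mem' {v w} hv hw t := by rw [map_add, hv t, hw t, smul_add]
  zero_mem' t := by simp
  smul_mem' b v hv t := by rw [map_smul, hv t, smul_comm]

open Classical in
/-- `M` is a weight module for an action of `h` if `M = ⨁_λ M_λ`. -/
def IsWeightAction (a : h →ₗ[k] Module.End k M) : Prop :=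
  DirectSum.IsInternal (weightSpace a)

/-- Weight modules over the Kac-Moody algebra `g`. -/
def IsWeightModule (M : Type*) [AddCommGroup M] [Module k M] [LieRingModule (D.Alg c) M]
    [LieModule k (D.Alg c) M] : Prop :=
  IsWeightAction ((LieModule.toEnd k (D.Alg c) M : D.Alg c →ₗ[k] Module.End k M) ∘ₗ D.cartan c)

/-- Weight modules over the Levi subalgebra `l_Ξ`. -/
def IsLeviWeightModule [CharZero k] (Ξ : Set ι) (N : Type*) [AddCommGroup N] [Module k N]
    [LieRingModule (D.levi c Ξ) N] [LieModule k (D.levi c Ξ) N] : Prop :=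
  IsWeightAction ((LieModule.toEnd k (D.levi c Ξ) N : D.levi c Ξ →ₗ[k] Module.End k N) ∘ₗ
    D.cartanLevi c Ξ)

end Weight

end KacMoodyDatum

end

/-!
Existence of the natural map amounts to a `p⁻_Ξ`-equivariant retraction of `Ind_{Ξ,!}(N)` onto
`1 ⊗ N`, that is, to a pairing `β : U(g) → End N` with `β 1 = 1` which is equivariant under `U(l_Ξ)`
on both sides and vanishes on `u⁻_Ξ U(g)` and on `U(g) u⁺_Ξ`; then `Φ(X ⊗ n)(X') = β(τ(X') X) n`.
Such a pairing is usually read off from the Poincaré-Birkhoff-Witt theorem. Here it is constructed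
directly (`LocalTriangular.exists_harishChandra`), using only that `g` is generated by `l_Ξ` and the
parts `g_1`, `g_{-1}` of degree `±1`, the degree being the number of simple roots outside `Ξ`. The
space `V = T(g_{-1}) ⊗ N` carries operators for the elements of `g_{-1}`, `l_Ξ`, `g_1`, defined by
recursion on words, that satisfy the commutation relations of the local part. The Lie algebra
`G ⊆ g × End V` generated by the local elements paired with their operators has a triangular
decomposition, from which it follows that an element of `G` lying over `0 ∈ g` maps `V` into the
kernel of the projection `V → N`. Dividing out the images of all such elements, one gets a module
over `g` to which the projection descends, and `β X n` is the projection of `X · n`.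

The natural map is unique because a homomorphism `Ψ` to `Ind_{Ξ,*}(N)` is determined by the map
`v ↦ Ψ(v)(1)` (`toFun_apply_eq`), which is `p⁻_Ξ`-equivariant, while `1 ⊗ N` generates
`Ind_{Ξ,!}(N)` under `p⁻_Ξ` (`eq_top_of_oneTensor_mem_of_parabolic`).

As `h` is finite-dimensional, the degree is the adjoint action of an element of `h`. It is central
in `l_Ξ`, so it acts on the simple weight module `N` by a scalar `s`, and `Ind_{Ξ,!}(N)` is the sum
of `1 ⊗ N` and of eigenspaces for the eigenvalues `s - 1, s - 2, …`. Hence a submodule contains the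
component in `1 ⊗ N` of each of its elements. The other components have value `0` at `1` under every
homomorphism to `Ind_{Ξ,*}(N)`, so a submodule meeting `1 ⊗ N` trivially lies in the kernel
(`le_ker_of_disjoint_oneTensor`). Simplicity of the image follows: the preimage of a non-zero
submodule meets `1 ⊗ N` in a non-zero `l_Ξ`-submodule, so in all of `1 ⊗ N`, which generates.
-/

/-! ### Lie algebras generated by a local part -/

section Triangular

variable {k L : Type*} [CommRing k] [LieRing L] [LieAlgebra k L]

theorem lie_mem_lieSpan_of_stable {Z A : Submodule k L}
    (hZ : ∀ z ∈ Z, ∀ a ∈ A, ⁅z, a⁆ ∈ A) {z x : L} (hz : z ∈ Z)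
    (hx : x ∈ LieSubalgebra.lieSpan k L (A : Set L)) :
    ⁅z, x⁆ ∈ LieSubalgebra.lieSpan k L (A : Set L) := by
  induction hx using LieSubalgebra.lieSpan_induction with
  | mem x hx => exact LieSubalgebra.subset_lieSpan (hZ z hz x hx)
  | zero => simp
  | add x y _ _ h1 h2 => rw [lie_add]; exact add_mem h1 h2
  | smul a x _ h1 => rw [lie_smul]; exact LieSubalgebra.smul_mem _ _ h1
  | lie x y hx hy h1 h2 =>
    rw [leibniz_lie]
    exact add_mem (LieSubalgebra.lie_mem _ h1 hy) (LieSubalgebra.lie_mem _ hx h2)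

theorem lie_mem_sup_lieSpan {Z A B : Submodule k L}
    (hZ : ∀ z ∈ Z, ∀ a ∈ A, ⁅z, a⁆ ∈ A) (hB : ∀ b ∈ B, ∀ a ∈ A, ⁅b, a⁆ ∈ Z) {b x : L}
    (hb : b ∈ B) (hx : x ∈ LieSubalgebra.lieSpan k L (A : Set L)) :
    ⁅b, x⁆ ∈ Z ⊔ (LieSubalgebra.lieSpan k L (A : Set L)).toSubmodule := by
  have key : ∀ x y, x ∈ Z ⊔ (LieSubalgebra.lieSpan k L (A : Set L)).toSubmodule →
      y ∈ LieSubalgebra.lieSpan k L (A : Set L) →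
      ⁅x, y⁆ ∈ LieSubalgebra.lieSpan k L (A : Set L) := by
    intro x y hx hy
    obtain ⟨z, hz, w, hw, rfl⟩ := Submodule.mem_sup.1 hx
    rw [add_lie]
    exact add_mem (lie_mem_lieSpan_of_stable hZ hz hy) (LieSubalgebra.lie_mem _ hw hy)
  induction hx using LieSubalgebra.lieSpan_induction with
  | mem x hx => exact Submodule.mem_sup_left (hB b hb x hx)
  | zero => simp
  | add x y _ _ h1 h2 => rw [lie_add]; exact add_mem h1 h2
  | smul a x _ h1 => rw [lie_smul]; exact Submodule.smul_mem _ _ h1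
  | lie x y hx hy h1 h2 =>
    rw [leibniz_lie, ← lie_skew x]
    exact Submodule.mem_sup_right (add_mem (key _ _ h1 hy) (neg_mem (key _ _ h2 hx)))

/-- If `Z` is closed under brackets and acts on `A` and `B`, and `[B, A] ⊆ Z`, then the Lie algebra
generated by `A`, `Z`, `B` is the sum of `Z` and of the Lie algebras generated by `A` and by `B`. -/
theorem lieSpan_le_triangular {Z A B : Submodule k L} (hZZ : ∀ z ∈ Z, ∀ w ∈ Z, ⁅z, w⁆ ∈ Z)
    (hZA : ∀ z ∈ Z, ∀ a ∈ A, ⁅z, a⁆ ∈ A) (hZB : ∀ z ∈ Z, ∀ b ∈ B, ⁅z, b⁆ ∈ B)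
    (hBA : ∀ b ∈ B, ∀ a ∈ A, ⁅b, a⁆ ∈ Z) :
    (LieSubalgebra.lieSpan k L (A ∪ Z ∪ B : Set L)).toSubmodule ≤
      (LieSubalgebra.lieSpan k L (A : Set L)).toSubmodule ⊔ Z ⊔
        (LieSubalgebra.lieSpan k L (B : Set L)).toSubmodule := by
  set T := (LieSubalgebra.lieSpan k L (A : Set L)).toSubmodule ⊔ Z ⊔
    (LieSubalgebra.lieSpan k L (B : Set L)).toSubmodule with hT
  have hA : (LieSubalgebra.lieSpan k L (A : Set L)).toSubmodule ≤ T := le_sup_left.trans le_sup_left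
  have hB : (LieSubalgebra.lieSpan k L (B : Set L)).toSubmodule ≤ T := le_sup_right
  have hZ : Z ≤ T := le_sup_right.trans le_sup_left
  have hAB : ∀ a ∈ A, ∀ b ∈ B, ⁅a, b⁆ ∈ Z := fun a ha b hb => by
    rw [← lie_skew]; exact neg_mem (hBA b hb a ha)
  let K : LieSubalgebra k L :=
    { carrier := {x | x ∈ T ∧ ∀ y ∈ T, ⁅x, y⁆ ∈ T}
      add_mem' := fun {x y} hx hy => ⟨add_mem hx.1 hy.1, fun z hz => by
        rw [add_lie]; exact add_mem (hx.2 z hz) (hy.2 z hz)⟩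
      zero_mem' := ⟨zero_mem _, fun z _ => by simp⟩
      smul_mem' := fun a x hx => ⟨T.smul_mem _ hx.1, fun z hz => by
        rw [smul_lie]; exact T.smul_mem _ (hx.2 z hz)⟩
      lie_mem' := fun {x y} hx hy => ⟨hx.2 _ hy.1, fun z hz => by
        rw [lie_lie]; exact sub_mem (hx.2 _ (hy.2 _ hz)) (hy.2 _ (hx.2 _ hz))⟩ }
  have hmem : ∀ x ∈ T, (∀ y ∈ LieSubalgebra.lieSpan k L (A : Set L), ⁅x, y⁆ ∈ T) →
      (∀ z ∈ Z, ⁅x, z⁆ ∈ T) → (∀ y ∈ LieSubalgebra.lieSpan k L (B : Set L), ⁅x, y⁆ ∈ T) →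
      x ∈ K := by
    intro x hx h1 h2 h3
    refine ⟨hx, fun y hy => ?_⟩
    obtain ⟨w, hw, b, hb, rfl⟩ := Submodule.mem_sup.1 hy
    obtain ⟨a, ha, z, hz, rfl⟩ := Submodule.mem_sup.1 hw
    rw [lie_add, lie_add]
    exact add_mem (add_mem (h1 a ha) (h2 z hz)) (h3 b hb)
  have hK : LieSubalgebra.lieSpan k L (A ∪ Z ∪ B : Set L) ≤ K := by
    refine LieSubalgebra.lieSpan_le.2 ?_
    rintro x ((hx | hx) | hx)
    · have hx' : x ∈ LieSubalgebra.lieSpan k L (A : Set L) := LieSubalgebra.subset_lieSpan hx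
      refine hmem x (hA hx') (fun y hy => hA (LieSubalgebra.lie_mem _ hx' hy)) (fun z hz => ?_)
        (fun y hy => sup_le hZ hB (lie_mem_sup_lieSpan hZB hAB hx hy))
      rw [← lie_skew]
      exact neg_mem (hA (LieSubalgebra.subset_lieSpan (hZA z hz x hx)))
    · exact hmem x (hZ hx) (fun y hy => hA (lie_mem_lieSpan_of_stable hZA hx hy))
        (fun z hz => hZ (hZZ x hx z hz)) (fun y hy => hB (lie_mem_lieSpan_of_stable hZB hx hy))
    · have hx' : x ∈ LieSubalgebra.lieSpan k L (B : Set L) := LieSubalgebra.subset_lieSpan hx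
      refine hmem x (hB hx') (fun y hy => sup_le hZ hA (lie_mem_sup_lieSpan hZA hBA hx hy))
        (fun z hz => ?_) (fun y hy => hB (LieSubalgebra.lie_mem _ hx' hy))
      rw [← lie_skew]
      exact neg_mem (hB (LieSubalgebra.subset_lieSpan (hZB z hz x hx)))
  exact fun x hx => (hK hx).1

end Triangular

/-! ### Recursion on the free module `T(M) ⊗ N` -/

section TensorRec

variable {k M N : Type*} [CommRing k] [AddCommGroup M] [Module k M] [AddCommGroup N] [Module k N]

namespace TensorAlgebra

variable (k M N) in
/-- Left multiplication by vectors of `M` on the free module `T(M) ⊗ N`. -/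
noncomputable def cons : M →ₗ[k] Module.End k (TensorAlgebra k M ⊗[k] N) :=
  LinearMap.rTensorHom N ∘ₗ LinearMap.mul k (TensorAlgebra k M) ∘ₗ TensorAlgebra.ι k

@[simp] theorem cons_tmul (y : M) (X : TensorAlgebra k M) (n : N) :
    cons k M N y (X ⊗ₜ[k] n) = (TensorAlgebra.ι k y * X) ⊗ₜ[k] n := rfl

theorem cons_induction {p : TensorAlgebra k M ⊗[k] N → Prop} (hadd : ∀ v w, p v → p w → p (v + w))
    (hone : ∀ n, p (1 ⊗ₜ n)) (hcons : ∀ y v, p v → p (cons k M N y v))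
    (v : TensorAlgebra k M ⊗[k] N) : p v := by
  have key : ∀ X Y : TensorAlgebra k M, (∀ n, p (Y ⊗ₜ n)) → ∀ n, p ((X * Y) ⊗ₜ n) := by
    intro X
    induction X using TensorAlgebra.induction with
    | algebraMap r =>
      intro Y hY n
      rw [← Algebra.smul_def, TensorProduct.smul_tmul]
      exact hY _
    | ι y => exact fun Y hY n => hcons y _ (hY n)
    | mul X X' h1 h2 => intro Y hY n; rw [mul_assoc]; exact h1 _ (h2 _ hY) n
    | add X X' h1 h2 =>
      intro Y hY n
      rw [add_mul, TensorProduct.add_tmul]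
      exact hadd _ _ (h1 Y hY n) (h2 Y hY n)
  induction v using TensorProduct.induction_on with
  | zero => simpa using hone 0
  | tmul X n => simpa using key X 1 hone n
  | add v w h1 h2 => exact hadd v w h1 h2

/-- Linear recursion on words: the value at `y · v` may depend linearly on `v` and on the value
at `v`. -/
theorem exists_cons_rec {W : Type*} [AddCommGroup W] [Module k W] (b : N →ₗ[k] W)
    (g : M →ₗ[k] (TensorAlgebra k M ⊗[k] N) →ₗ[k] W) (s : M →ₗ[k] W →ₗ[k] W) :
    ∃ F : (TensorAlgebra k M ⊗[k] N) →ₗ[k] W, (∀ n, F (1 ⊗ₜ n) = b n) ∧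
      ∀ y v, F (cons k M N y v) = g y v + s y (F v) := by
  let V := TensorAlgebra k M ⊗[k] N
  -- the recursion carries along the word read so far
  let op : M →ₗ[k] Module.End k (V × W) :=
    { toFun := fun y => LinearMap.prod (cons k M N y ∘ₗ LinearMap.fst k V W)
        (g y ∘ₗ LinearMap.fst k V W + s y ∘ₗ LinearMap.snd k V W)
      map_add' := fun y z => LinearMap.ext fun p => Prod.ext (by simp) (by
        change g (y + z) p.1 + s (y + z) p.2 = g y p.1 + s y p.2 + (g z p.1 + s z p.2)
        rw [map_add, map_add, LinearMap.add_apply, LinearMap.add_apply]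
        abel)
      map_smul' := fun a y => LinearMap.ext fun p => Prod.ext (by simp) (by simp) }
  let base : N →ₗ[k] V × W := LinearMap.prod (TensorProduct.mk k _ N 1) b
  let F0 : V →ₗ[k] V × W :=
    TensorProduct.lift ((LinearMap.lcomp k (V × W) base) ∘ₗ (TensorAlgebra.lift k op).toLinearMap)
  have hF0 : ∀ X n, F0 (X ⊗ₜ n) = TensorAlgebra.lift k op X (base n) := fun _ _ => rfl
  have h1 : ∀ n, F0 (1 ⊗ₜ n) = (1 ⊗ₜ n, b n) := fun n => by rw [hF0, map_one]; rfl
  have h2 : ∀ y v, F0 (cons k M N y v) = op y (F0 v) := by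
    intro y v
    induction v using TensorProduct.induction_on with
    | zero => simp
    | tmul X n => rw [cons_tmul, hF0, hF0, map_mul, TensorAlgebra.lift_ι_apply]; rfl
    | add v w h1 h2 => simp only [map_add, h1, h2]
  have h3 : ∀ v, (F0 v).1 = v := by
    intro v
    induction v using cons_induction with
    | hadd v w h1 h2 => rw [map_add, Prod.fst_add, h1, h2]
    | hone n => rw [h1]
    | hcons y v h => rw [h2]; change cons k M N y (F0 v).1 = _; rw [h]
  refine ⟨LinearMap.snd k V W ∘ₗ F0, fun n => by simp [h1], fun y v => ?_⟩
  rw [LinearMap.comp_apply, h2]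
  change g y (F0 v).1 + s y (F0 v).2 = _
  rw [h3]
  rfl

end TensorAlgebra

end TensorRec

/-! ### The Harish-Chandra pairing of a triangular decomposition -/

/-- A Lie algebra `L` with subalgebras `neg`, `l`, `pos` meeting as in a triangular decomposition,
and subspaces `negGen ⊆ neg`, `posGen ⊆ pos` which generate `L` together with `l` and which behave
like the homogeneous parts of degree `-1` and `1` of a grading with `l` in degree `0`. -/
structure LocalTriangular {k L : Type*} [CommRing k] [LieRing L] [LieAlgebra k L]
    (l : LieSubalgebra k L) where
  neg : LieSubalgebra k L
  pos : LieSubalgebra k L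
  negGen : Submodule k L
  posGen : Submodule k L
  negGen_le : negGen ≤ neg.toSubmodule
  posGen_le : posGen ≤ pos.toSubmodule
  lie_negGen : ∀ a ∈ l, ∀ y ∈ negGen, ⁅a, y⁆ ∈ negGen
  lie_posGen : ∀ a ∈ l, ∀ x ∈ posGen, ⁅a, x⁆ ∈ posGen
  posGen_lie_negGen : ∀ x ∈ posGen, ∀ y ∈ negGen, ⁅x, y⁆ ∈ l
  lieSpan_eq_top : LieSubalgebra.lieSpan k L (negGen ∪ l ∪ posGen : Set L) = ⊤
  eq_zero : ∀ y ∈ neg, ∀ a ∈ l, ∀ x ∈ pos, y + a + x = 0 → y = 0 ∧ a = 0 ∧ x = 0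

namespace LocalTriangular

attribute [local instance] LieRing.ofAssociativeRing

variable {k L : Type*} [CommRing k] [LieRing L] [LieAlgebra k L] {l : LieSubalgebra k L}
  (T : LocalTriangular l)
  {N : Type*} [AddCommGroup N] [Module k N] [LieRingModule l N] [LieModule k l N]

open TensorAlgebra (cons cons_induction exists_cons_rec)

/-- The bracket of an element of `l` with an element of `negGen`. -/
def actNegGen : l →ₗ[k] T.negGen →ₗ[k] T.negGen :=
  LinearMap.mk₂ k (fun a y => ⟨⁅(a : L), (y : L)⁆, T.lie_negGen a a.2 y y.2⟩)
    (fun a b y => Subtype.ext (by simp)) (fun r a y => Subtype.ext (by simp))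
    (fun a y z => Subtype.ext (by simp)) (fun r a y => Subtype.ext (by simp))

/-- The bracket of an element of `l` with an element of `posGen`. -/
def actPosGen (a : l) (x : T.posGen) : T.posGen := ⟨⁅(a : L), (x : L)⁆, T.lie_posGen a a.2 x x.2⟩

/-- The bracket of an element of `posGen` with an element of `negGen`. -/
def genBracket : T.posGen →ₗ[k] T.negGen →ₗ[k] l :=
  LinearMap.mk₂ k (fun x y => ⟨⁅(x : L), (y : L)⁆, T.posGen_lie_negGen x x.2 y y.2⟩)
    (fun a b y => Subtype.ext (by simp)) (fun r a y => Subtype.ext (by simp))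
    (fun a y z => Subtype.ext (by simp)) (fun r a y => Subtype.ext (by simp))

/-- The derivation action of `l` on the free module `T(negGen) ⊗ N`. -/
theorem exists_levi_action : ∃ ρ : l →ₗ[k] Module.End k (TensorAlgebra k T.negGen ⊗[k] N),
    (∀ a n, ρ a (1 ⊗ₜ n) = 1 ⊗ₜ ⁅a, n⁆) ∧
    ∀ a y v, ρ a (cons k _ N y v) = cons k _ N (T.actNegGen a y) v + cons k _ N y (ρ a v) := by
  obtain ⟨F, h1, h2⟩ := exists_cons_rec (M := T.negGen) (N := N)
    (W := l →ₗ[k] (TensorAlgebra k T.negGen ⊗[k] N))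
    ((LinearMap.llcomp k l N _ (TensorProduct.mk k _ N 1)) ∘ₗ
      (LieModule.toEnd k l N : l →ₗ[k] Module.End k N).flip)
    (LinearMap.mk₂ k (fun y v => (cons k _ N).flip v ∘ₗ T.actNegGen.flip y)
      (fun y z v => by ext; simp) (fun r y v => by ext; simp) (fun y v w => by ext; simp)
      (fun r y v => by ext; simp))
    ((LinearMap.llcomp k l _ _) ∘ₗ cons k T.negGen N)
  exact ⟨F.flip, fun a n => by rw [LinearMap.flip_apply, h1]; rfl,
    fun a y v => by rw [LinearMap.flip_apply, h2]; rfl⟩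

omit [LieRingModule l N] [LieModule k l N] in
/-- The action of `posGen` on the free module `T(negGen) ⊗ N` that kills `1 ⊗ N` and has the
prescribed commutators with the left multiplications. -/
theorem exists_posGen_action (ρ : l →ₗ[k] Module.End k (TensorAlgebra k T.negGen ⊗[k] N)) :
    ∃ σ : T.posGen →ₗ[k] Module.End k (TensorAlgebra k T.negGen ⊗[k] N),
      (∀ x n, σ x (1 ⊗ₜ n) = 0) ∧
      ∀ x y v, σ x (cons k _ N y v) = ρ (T.genBracket x y) v + cons k _ N y (σ x v) := by
  obtain ⟨F, h1, h2⟩ := exists_cons_rec (M := T.negGen) (N := N)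
    (W := T.posGen →ₗ[k] (TensorAlgebra k T.negGen ⊗[k] N)) 0
    (LinearMap.mk₂ k (fun y v => ρ.flip v ∘ₗ T.genBracket.flip y)
      (fun y z v => by ext; simp) (fun r y v => by ext; simp) (fun y v w => by ext; simp)
      (fun r y v => by ext; simp))
    ((LinearMap.llcomp k T.posGen _ _) ∘ₗ cons k T.negGen N)
  exact ⟨F.flip, fun a n => by rw [LinearMap.flip_apply, h1]; rfl,
    fun a y v => by rw [LinearMap.flip_apply, h2]; rfl⟩

variable (N) in
/-- A module over the local part `negGen ⊕ l ⊕ posGen`, whose three summands act by the operators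
`μ`, `ρ` and `σ`. It is generated by a copy `i` of the `l`-module `N`
under `negGen`, with `posGen` killing `N`, and with an `l`-equivariant retraction `π` onto `N`
that kills the image of `negGen`. -/
structure LocalModule (V : Type*) [AddCommGroup V] [Module k V] where
  μ : T.negGen →ₗ[k] Module.End k V
  ρ : l →ₗ[k] Module.End k V
  σ : T.posGen →ₗ[k] Module.End k V
  i : N →ₗ[k] V
  π : V →ₗ[k] N
  π_i : ∀ n, π (i n) = n
  π_μ : ∀ y v, π (μ y v) = 0
  π_ρ : ∀ a v, π (ρ a v) = ⁅a, π v⁆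
  ρ_i : ∀ a n, ρ a (i n) = i ⁅a, n⁆
  σ_i : ∀ x n, σ x (i n) = 0
  ρ_ρ : ∀ a b v, ρ ⁅a, b⁆ v = ρ a (ρ b v) - ρ b (ρ a v)
  ρ_μ : ∀ a y v, μ (T.actNegGen a y) v = ρ a (μ y v) - μ y (ρ a v)
  ρ_σ : ∀ a x v, σ (T.actPosGen a x) v = ρ a (σ x v) - σ x (ρ a v)
  σ_μ : ∀ x y v, ρ (T.genBracket x y) v = σ x (μ y v) - μ y (σ x v)
  induction : ∀ {p : V → Prop}, (∀ v w, p v → p w → p (v + w)) → (∀ n, p (i n)) →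
    (∀ y v, p v → p (μ y v)) → ∀ v, p v

/-- The free module `T(negGen) ⊗ N` over the tensor algebra is a module over the local part. -/
theorem nonempty_localModule :
    Nonempty (T.LocalModule N (TensorAlgebra k T.negGen ⊗[k] N)) := by
  obtain ⟨ρ, hρ1, hρ⟩ := T.exists_levi_action (N := N)
  obtain ⟨σ, hσ1, hσ⟩ := T.exists_posGen_action ρ
  let π : (TensorAlgebra k T.negGen ⊗[k] N) →ₗ[k] N := TensorProduct.lid k N ∘ₗ
    LinearMap.rTensor N (TensorAlgebra.algebraMapInv (R := k) (M := T.negGen)).toLinearMap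
  have hπ1 : ∀ n, π (1 ⊗ₜ n) = n := fun n => by simp [π]
  have hπ : ∀ y v, π (cons k _ N y v) = 0 := by
    intro y v
    induction v using TensorProduct.induction_on with
    | zero => simp
    | tmul X n => simp [π, TensorAlgebra.algebraMapInv]
    | add v w h1 h2 => rw [map_add, map_add, h1, h2, add_zero]
  have hπρ : ∀ a v, π (ρ a v) = ⁅a, π v⁆ := by
    intro a v
    induction v using cons_induction with
    | hadd v w h1 h2 => simp only [map_add, h1, h2, lie_add]
    | hone n => rw [hρ1, hπ1, hπ1]
    | hcons y v h => rw [hρ, map_add, hπ, hπ, hπ, lie_zero, add_zero]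
  have hρρ : ∀ a b v, ρ ⁅a, b⁆ v = ρ a (ρ b v) - ρ b (ρ a v) := by
    intro a b v
    induction v using cons_induction with
    | hadd v w h1 h2 => simp only [map_add, h1, h2]; abel
    | hone n => simp only [hρ1, lie_lie, TensorProduct.tmul_sub]
    | hcons y v h =>
      have : T.actNegGen ⁅a, b⁆ y = T.actNegGen a (T.actNegGen b y) -
          T.actNegGen b (T.actNegGen a y) := Subtype.ext (lie_lie (a : L) (b : L) (y : L))
      simp only [hρ, h, this, map_sub, map_add, LinearMap.sub_apply]
      abel
  have hρσ : ∀ a x v, σ (T.actPosGen a x) v = ρ a (σ x v) - σ x (ρ a v) := by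
    intro a x v
    induction v using cons_induction with
    | hadd v w h1 h2 => simp only [map_add, h1, h2]; abel
    | hone n => simp only [hρ1, hσ1, map_zero, sub_zero]
    | hcons y v h =>
      have : T.genBracket (T.actPosGen a x) y = ⁅a, T.genBracket x y⁆ -
          T.genBracket x (T.actNegGen a y) :=
        Subtype.ext (lie_lie (a : L) (x : L) (y : L))
      simp only [hρ, hσ, h, this, map_sub, map_add, LinearMap.sub_apply, hρρ]
      abel
  exact ⟨{
    μ := cons k T.negGen N, ρ := ρ, σ := σ, i := TensorProduct.mk k _ N 1, π := π
    π_i := hπ1, π_μ := hπ, π_ρ := hπρ, ρ_i := hρ1, σ_i := hσ1, ρ_ρ := hρρ, ρ_σ := hρσ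
    ρ_μ := fun a y v => by rw [hρ, add_sub_cancel_right]
    σ_μ := fun x y v => by rw [hσ, add_sub_cancel_right]
    induction := fun h1 h2 h3 v => cons_induction h1 h2 h3 v }⟩

omit [LieModule k l N] in
/-- Some quotient of a module over the local part is a module over `L`, and the retraction onto
`N` descends to it. The Lie algebra generated inside `L × End V` by the local elements paired with
their operators has a triangular decomposition; hence the elements of it lying over `0 ∈ L` have
image in the kernel of the retraction, and their image can be divided out. -/
theorem LocalModule.exists_quotient {V : Type*} [AddCommGroup V] [Module k V]
    (M : T.LocalModule N V) : ∃ (S : Submodule k V) (hS : S ≤ LinearMap.ker M.π)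
    (θ : L →ₗ⁅k⁆ Module.End k (V ⧸ S)), (∀ (a : l) v, θ a (S.mkQ v) = S.mkQ (M.ρ a v)) ∧
    (∀ x ∈ T.pos, ∀ n, θ x (S.mkQ (M.i n)) = 0) ∧
    (∀ y ∈ T.neg, ∀ v, S.liftQ M.π hS (θ y v) = 0) := by
  -- the Lie algebra generated by the pairs of a local element and its operator
  let B : Submodule k (L × Module.End k V) :=
    LinearMap.range (T.posGen.subtype.prod M.σ)
  let Z : Submodule k (L × Module.End k V) :=
    LinearMap.range (l.toSubmodule.subtype.prod M.ρ)
  let A : Submodule k (L × Module.End k V) :=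
    LinearMap.range (T.negGen.subtype.prod (M.μ))
  have hA : ∀ y : T.negGen, ((y : L), M.μ y) ∈ A := fun y => ⟨y, rfl⟩
  have hZ : ∀ a : l, ((a : L), M.ρ a) ∈ Z := fun y => ⟨y, rfl⟩
  have hB : ∀ x : T.posGen, ((x : L), M.σ x) ∈ B := fun y => ⟨y, rfl⟩
  let G := LieSubalgebra.lieSpan k (L × Module.End k V) (A ∪ Z ∪ B : Set _)
  have htri : ∀ u ∈ G, ∃ y ∈ LieSubalgebra.lieSpan k _ (A : Set (L × Module.End k V)), ∃ a : l,
      ∃ x ∈ LieSubalgebra.lieSpan k _ (B : Set (L × Module.End k V)),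
      u = y + ((a : L), M.ρ a) + x := by
    intro u hu
    have := lieSpan_le_triangular (A := A) (Z := Z) (B := B) ?_ ?_ ?_ ?_ hu
    · obtain ⟨w, hw, x, hx, rfl⟩ := Submodule.mem_sup.1 this
      obtain ⟨y, hy, _, ⟨a, rfl⟩, rfl⟩ := Submodule.mem_sup.1 hw
      exact ⟨y, hy, a, x, hx, rfl⟩
    · rintro _ ⟨(a : l), rfl⟩ _ ⟨(b : l), rfl⟩
      exact ⟨(⁅a, b⁆ : l), Prod.ext rfl (LinearMap.ext fun v => M.ρ_ρ a b v)⟩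
    · rintro _ ⟨a, rfl⟩ _ ⟨y, rfl⟩
      refine ⟨T.actNegGen a y, Prod.ext rfl (LinearMap.ext fun v => ?_)⟩
      change M.μ (T.actNegGen a y) v = M.ρ a (M.μ y v) - M.μ y (M.ρ a v)
      exact M.ρ_μ a y v
    · rintro _ ⟨a, rfl⟩ _ ⟨x, rfl⟩
      exact ⟨T.actPosGen a x, Prod.ext rfl (LinearMap.ext fun v => M.ρ_σ a x v)⟩
    · rintro _ ⟨x, rfl⟩ _ ⟨y, rfl⟩
      refine ⟨T.genBracket x y, Prod.ext rfl (LinearMap.ext fun v => ?_)⟩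
      change M.ρ (T.genBracket x y) v = M.σ x (M.μ y v) - M.μ y (M.σ x v)
      exact M.σ_μ x y v
  have hneg : ∀ u ∈ LieSubalgebra.lieSpan k _ (A : Set (L × Module.End k V)),
      u.1 ∈ T.neg ∧ ∀ v, M.π (u.2 v) = 0 := by
    intro u hu
    induction hu using LieSubalgebra.lieSpan_induction with
    | mem u hu => obtain ⟨y, rfl⟩ := hu; exact ⟨T.negGen_le y.2, fun v => M.π_μ y v⟩
    | zero => exact ⟨zero_mem _, fun v => map_zero M.π⟩
    | add u w _ _ h1 h2 =>
      exact ⟨add_mem h1.1 h2.1, fun v => (map_add M.π _ _).trans (by rw [h1.2, h2.2, add_zero])⟩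
    | smul r u _ h1 =>
      exact ⟨T.neg.smul_mem _ h1.1, fun v => (map_smul M.π _ _).trans (by rw [h1.2, smul_zero])⟩
    | lie u w _ _ h1 h2 =>
      exact ⟨T.neg.lie_mem h1.1 h2.1,
        fun v => (map_sub M.π _ _).trans (by
          rw [Module.End.mul_apply, Module.End.mul_apply, h1.2, h2.2, sub_zero])⟩
  have hpos : ∀ u ∈ LieSubalgebra.lieSpan k _ (B : Set (L × Module.End k V)),
      u.1 ∈ T.pos ∧ ∀ n, u.2 (M.i n) = 0 := by
    intro u hu
    induction hu using LieSubalgebra.lieSpan_induction with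
    | mem u hu => obtain ⟨x, rfl⟩ := hu; exact ⟨T.posGen_le x.2, fun n => M.σ_i x n⟩
    | zero => exact ⟨zero_mem _, fun v => rfl⟩
    | add u w _ _ h1 h2 =>
      exact ⟨add_mem h1.1 h2.1, fun n => by
        rw [Prod.snd_add, LinearMap.add_apply, h1.2, h2.2, add_zero]⟩
    | smul r u _ h1 =>
      exact ⟨T.pos.smul_mem _ h1.1, fun n => by
        rw [Prod.smul_snd, LinearMap.smul_apply, h1.2, smul_zero]⟩
    | lie u w _ _ h1 h2 =>
      refine ⟨T.pos.lie_mem h1.1 h2.1, fun n => ?_⟩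
      change u.2 (w.2 _) - w.2 (u.2 _) = 0
      rw [h1.2, h2.2, map_zero, map_zero, sub_zero]
  -- `π` does not see the elements of `G` lying over zero
  have hker : ∀ v, ∀ u ∈ G, u.1 = 0 → M.π (u.2 v) = 0 := by
    refine M.induction ?_ ?_ ?_
    · intro v w h1 h2 u hu h0
      rw [map_add, map_add, h1 u hu h0, h2 u hu h0, add_zero]
    · intro n u hu h0
      obtain ⟨y, hy, a, x, hx, rfl⟩ := htri u hu
      obtain ⟨-, ha, -⟩ := T.eq_zero _ (hneg y hy).1 a a.2 _ (hpos x hx).1 h0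
      have ha' : a = 0 := Subtype.ext ha
      subst ha'
      change M.π (y.2 (M.i n) + M.ρ 0 (M.i n) + x.2 (M.i n)) = 0
      rw [(hpos x hx).2, map_zero, LinearMap.zero_apply, add_zero, add_zero, (hneg y hy).2]
    · intro y v h u hu h0
      have hy : ((y : L), M.μ y) ∈ G :=
        LieSubalgebra.subset_lieSpan (Or.inl (Or.inl (hA y)))
      have h1 := h _ (G.lie_mem hu hy) (by
        change ⁅u.1, (y : L)⁆ = 0
        rw [h0, zero_lie])
      change M.π (u.2 (M.μ y v) - M.μ y (u.2 v)) = 0 at h1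
      rwa [map_sub, M.π_μ, sub_zero] at h1
  have hsurj : ∀ x : L, ∃ u ∈ G, u.1 = x := by
    have : LieSubalgebra.lieSpan k L (T.negGen ∪ l ∪ T.posGen : Set L) ≤
        G.map (LieHom.fst k L (Module.End k V)) := by
      refine LieSubalgebra.lieSpan_le.2 ?_
      rintro x ((hx | hx) | hx)
      · exact ⟨_, LieSubalgebra.subset_lieSpan (Or.inl (Or.inl (hA ⟨x, hx⟩))), rfl⟩
      · exact ⟨_, LieSubalgebra.subset_lieSpan (Or.inl (Or.inr (hZ ⟨x, hx⟩))), rfl⟩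
      · exact ⟨_, LieSubalgebra.subset_lieSpan (Or.inr (hB ⟨x, hx⟩)), rfl⟩
    intro x
    have hx : x ∈ G.map (LieHom.fst k L (Module.End k V)) := this (by
      rw [T.lieSpan_eq_top]; exact LieSubalgebra.mem_top x)
    obtain ⟨u, hu, rfl⟩ := hx
    exact ⟨u, hu, rfl⟩
  -- the quotient on which `L` acts
  let S : Submodule k V := Submodule.span k {w | ∃ u ∈ G, u.1 = 0 ∧ ∃ v, u.2 v = w}
  have hSmem : ∀ u ∈ G, u.1 = 0 → ∀ v, u.2 v ∈ S :=
    fun u hu h0 v => Submodule.subset_span ⟨u, hu, h0, v, rfl⟩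
  have hS : ∀ u ∈ G, S ≤ S.comap u.2 := by
    intro u hu
    refine Submodule.span_le.2 ?_
    rintro _ ⟨w, hw, h0, v, rfl⟩
    have h1 := hSmem _ (G.lie_mem hu hw) (by
      change ⁅u.1, w.1⁆ = 0
      rw [h0, lie_zero]) v
    change u.2 (w.2 v) - w.2 (u.2 v) ∈ S at h1
    exact (S.sub_mem_iff_left (hSmem w hw h0 _)).1 h1
  have hSπ : S ≤ LinearMap.ker M.π := by
    refine Submodule.span_le.2 ?_
    rintro _ ⟨w, hw, h0, v, rfl⟩
    exact hker v w hw h0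
  choose s hsG hs using hsurj
  have hlift : ∀ u ∈ G, ∀ v, S.mapQ S (s u.1).2 (hS _ (hsG _)) (S.mkQ v) = S.mkQ (u.2 v) := by
    intro u hu v
    rw [← sub_eq_zero, Submodule.mkQ_apply, Submodule.mapQ_apply, Submodule.mkQ_apply,
      ← Submodule.Quotient.mk_sub, Submodule.Quotient.mk_eq_zero]
    exact hSmem _ (sub_mem (hsG u.1) hu) (by rw [Prod.fst_sub, hs, sub_self]) v
  let θ : L →ₗ⁅k⁆ Module.End k (V ⧸ S) :=
    { toFun := fun x => S.mapQ S (s x).2 (hS _ (hsG x))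
      map_add' := fun x y => Submodule.linearMap_qext _ (LinearMap.ext fun v => by
        have := hlift _ (add_mem (hsG x) (hsG y)) v
        rw [Prod.fst_add, hs, hs] at this
        exact this)
      map_smul' := fun r x => Submodule.linearMap_qext _ (LinearMap.ext fun v => by
        have := hlift _ (G.smul_mem r (hsG x)) v
        rw [Prod.smul_fst, hs] at this
        exact this)
      map_lie' := fun {x y} => Submodule.linearMap_qext _ (LinearMap.ext fun v => by
        have := hlift _ (G.lie_mem (hsG x) (hsG y)) v
        rw [LieAlgebra.Prod.bracket_apply, hs, hs] at this
        exact this) }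
  have hθ : ∀ u ∈ G, ∀ v, θ u.1 (S.mkQ v) = S.mkQ (u.2 v) := hlift
  have hθl : ∀ (a : l) v, θ a (S.mkQ v) = S.mkQ (M.ρ a v) :=
    fun a v => hθ _ (LieSubalgebra.subset_lieSpan (Or.inl (Or.inr (hZ a)))) v
  have hGA : LieSubalgebra.lieSpan k _ (A : Set (L × Module.End k V)) ≤ G :=
    LieSubalgebra.lieSpan_le.2 fun u hu => LieSubalgebra.subset_lieSpan (Or.inl (Or.inl hu))
  have hGB : LieSubalgebra.lieSpan k _ (B : Set (L × Module.End k V)) ≤ G :=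
    LieSubalgebra.lieSpan_le.2 fun u hu => LieSubalgebra.subset_lieSpan (Or.inr hu)
  refine ⟨S, hSπ, θ, hθl, ?_, ?_⟩
  · intro x hx n
    obtain ⟨y', hy', a, x', hx', h⟩ := htri _ (hsG x)
    have h1 : y'.1 + a + (x'.1 - x) = 0 := by
      rw [← add_sub_assoc, sub_eq_zero, ← hs x, h]; rfl
    have h2 := (T.eq_zero _ (hneg y' hy').1 a a.2 _ (sub_mem (hpos x' hx').1 hx) h1).2.2
    rw [sub_eq_zero] at h2
    subst h2
    refine (hθ x' (hGB hx') _).trans ?_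
    change S.mkQ (x'.2 (M.i n)) = 0
    rw [(hpos x' hx').2, map_zero]
  · intro y hy v
    obtain ⟨v, rfl⟩ := S.mkQ_surjective v
    obtain ⟨y', hy', a, x', hx', h⟩ := htri _ (hsG y)
    have h1 : (y'.1 - y) + a + x'.1 = 0 := by
      have : y = y'.1 + a + x'.1 := by rw [← hs y, h]; rfl
      rw [this]; abel
    have h2 := (T.eq_zero _ (sub_mem (hneg y' hy').1 hy) a a.2 _ (hpos x' hx').1 h1).1
    rw [sub_eq_zero] at h2
    subst h2
    rw [hθ y' (hGA hy')]
    exact (hneg y' hy').2 v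

/-- For a Lie algebra `L` with a triangular decomposition `neg ⊕ l ⊕ pos` and an `l`-module `N`,
a Harish-Chandra pairing `U(L) → End N`: a linear map with `1 ↦ 1` that is equivariant
under `U(l)` on both sides and kills `neg · U(L)` and `U(L) · pos`. -/
theorem exists_harishChandra : ∃ β : UniversalEnvelopingAlgebra k L →ₗ[k] Module.End k N,
    β 1 = 1 ∧
    (∀ (a : l) X n, β (UniversalEnvelopingAlgebra.ι k (a : L) * X) n = ⁅a, β X n⁆) ∧
    (∀ (a : l) X n, β (X * UniversalEnvelopingAlgebra.ι k (a : L)) n = β X ⁅a, n⁆) ∧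
    (∀ y ∈ T.neg, ∀ X, β (UniversalEnvelopingAlgebra.ι k y * X) = 0) ∧
    (∀ x ∈ T.pos, ∀ X, β (X * UniversalEnvelopingAlgebra.ι k x) = 0) := by
  obtain ⟨M⟩ := T.nonempty_localModule (N := N)
  obtain ⟨S, hS, θ, hl, hpos, hneg⟩ := M.exists_quotient
  let j := S.mkQ ∘ₗ M.i
  have hπ : ∀ (a : l) v, S.liftQ M.π hS (θ a v) = ⁅a, S.liftQ M.π hS v⁆ := by
    intro a v
    obtain ⟨v, rfl⟩ := S.mkQ_surjective v
    rw [hl]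
    exact M.π_ρ a v
  refine ⟨(LinearMap.lcomp k N j ∘ₗ LinearMap.compRight k (S.liftQ M.π hS)) ∘ₗ
    (UniversalEnvelopingAlgebra.lift k θ).toLinearMap, ?_, ?_, ?_, ?_, ?_⟩
  · ext n
    simpa [j] using M.π_i n
  · intro a X n
    simp only [LinearMap.comp_apply, AlgHom.toLinearMap_apply, map_mul,
      UniversalEnvelopingAlgebra.lift_ι_apply]
    exact hπ a _
  · intro a X n
    simp only [LinearMap.comp_apply, AlgHom.toLinearMap_apply, map_mul,
      UniversalEnvelopingAlgebra.lift_ι_apply]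
    refine congrArg (fun v => S.liftQ M.π hS (UniversalEnvelopingAlgebra.lift k θ X v)) ?_
    exact (hl a _).trans (congrArg S.mkQ (M.ρ_i a n))
  · intro y hy X
    ext n
    simp only [LinearMap.comp_apply, AlgHom.toLinearMap_apply, map_mul,
      UniversalEnvelopingAlgebra.lift_ι_apply]
    exact hneg y hy _
  · intro x hx X
    ext n
    simp only [LinearMap.comp_apply, AlgHom.toLinearMap_apply, map_mul,
      UniversalEnvelopingAlgebra.lift_ι_apply]
    refine (congrArg (fun v => S.liftQ M.π hS (UniversalEnvelopingAlgebra.lift k θ X v))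
      (hpos x hx n)).trans ?_
    simp

end LocalTriangular

/-! ### Auxiliary results on enveloping algebras and eigenspaces -/

/-- Induction principle: the enveloping algebra is generated by the image of `L`. -/
theorem UniversalEnvelopingAlgebra.induction {k L : Type*} [CommRing k] [LieRing L]
    [LieAlgebra k L] {p : UniversalEnvelopingAlgebra k L → Prop}
    (algebraMap : ∀ r, p (algebraMap k _ r)) (ι : ∀ x, p (UniversalEnvelopingAlgebra.ι k x))
    (mul : ∀ X Y, p X → p Y → p (X * Y)) (add : ∀ X Y, p X → p Y → p (X + Y))
    (X : UniversalEnvelopingAlgebra k L) : p X := by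
  obtain ⟨X, rfl⟩ : ∃ Y, UniversalEnvelopingAlgebra.mkAlgHom k L Y = X :=
    RingCon.mk'_surjective _ X
  induction X using TensorAlgebra.induction with
  | algebraMap r => rw [AlgHom.commutes]; exact algebraMap r
  | ι x => exact ι x
  | mul X Y h1 h2 => rw [map_mul]; exact mul _ _ h1 h2
  | add X Y h1 h2 => rw [map_add]; exact add _ _ h1 h2

/-- If a stable subspace contains the sum of an eigenvector and of eigenvectors for other
eigenvalues, it contains the first summand. -/
theorem Module.End.mem_of_add_mem_of_mem_iSup_eigenspace {k M : Type*} [Field k] [AddCommGroup M]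
    [Module k M] (T : Module.End k M) (U : Submodule k M) (hU : ∀ v ∈ U, T v ∈ U) {c : k}
    {v w : M} (hv : T v = c • v) (hw : w ∈ ⨆ μ ∈ {μ : k | μ ≠ c}, T.eigenspace μ)
    (hvw : v + w ∈ U) : v ∈ U := by
  -- some polynomial in `T` kills `w` and acts on `v` by a non-zero scalar
  obtain ⟨q, hq, hqw⟩ : ∃ q : Polynomial k, q.eval c ≠ 0 ∧ Polynomial.aeval T q w = 0 := by
    clear hvw
    induction hw using Submodule.iSup_induction' with
    | mem μ w hw =>
      induction hw using Submodule.iSup_induction' with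
      | mem hμ w hw =>
        refine ⟨Polynomial.X - Polynomial.C μ, ?_, ?_⟩
        · simpa [sub_eq_zero] using Ne.symm hμ
        · rw [Module.End.mem_eigenspace_iff] at hw
          simp [hw]
      | zero => exact ⟨1, by simp, by simp⟩
      | add x y _ _ h1 h2 =>
        obtain ⟨p, hp, hpx⟩ := h1
        obtain ⟨q, hq, hqy⟩ := h2
        refine ⟨p * q, by simp [hp, hq], ?_⟩
        rw [map_add, map_mul, Module.End.mul_apply, Module.End.mul_apply, hqy, map_zero, add_zero,
          ← Module.End.mul_apply, (Commute.all p q).map (Polynomial.aeval T) |>.eq,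
          Module.End.mul_apply, hpx, map_zero]
    | zero => exact ⟨1, by simp, by simp⟩
    | add x y _ _ h1 h2 =>
      obtain ⟨p, hp, hpx⟩ := h1
      obtain ⟨q, hq, hqy⟩ := h2
      refine ⟨p * q, by simp [hp, hq], ?_⟩
      rw [map_add, map_mul, Module.End.mul_apply, Module.End.mul_apply, hqy, map_zero, add_zero,
        ← Module.End.mul_apply, (Commute.all p q).map (Polynomial.aeval T) |>.eq,
        Module.End.mul_apply, hpx, map_zero]
  have hstab : ∀ r : Polynomial k, ∀ u ∈ U, Polynomial.aeval T r u ∈ U := by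
    intro r
    induction r using Polynomial.induction_on' with
    | add p q h1 h2 => intro u hu; rw [map_add]; exact add_mem (h1 u hu) (h2 u hu)
    | monomial n a =>
      intro u hu
      rw [Polynomial.aeval_monomial, ← Algebra.smul_def, LinearMap.smul_apply]
      refine U.smul_mem _ ?_
      induction n with
      | zero => simpa using hu
      | succ n ih => rw [pow_succ', Module.End.mul_apply]; exact hU _ ih
  have h1 := hstab q _ hvw
  by_cases hv0 : v = 0
  · rw [hv0]; exact zero_mem U
  rw [map_add, hqw, add_zero,
    Module.End.aeval_apply_of_hasEigenvector ⟨Module.End.mem_eigenspace_iff.2 hv, hv0⟩] at h1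
  exact (U.smul_mem_iff hq).1 h1

namespace KacMoodyDatum

attribute [local instance] LieRing.ofAssociativeRing

/-! ### Weight spaces -/

section General

variable {k h M M' : Type*} [Field k] [AddCommGroup h] [Module k h] [AddCommGroup M] [Module k M]
  [AddCommGroup M'] [Module k M']

theorem iSupIndep_weightSpace (a : h →ₗ[k] Module.End k M) (ha : ∀ s t, Commute (a s) (a t)) :
    iSupIndep (weightSpace a) := by
  have h1 := Module.End.independent_iInf_maxGenEigenspace_of_forall_mapsTo a (fun s t c =>
      Module.End.mapsTo_maxGenEigenspace_of_comm (ha t s) c)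
  have h2 := h1.comp (f := fun α : Dual k h => (α : h → k)) DFunLike.coe_injective
  refine h2.mono fun α x hx => ?_
  simp only [Function.comp_apply, Submodule.mem_iInf]
  intro t
  refine (Module.End.genEigenspace _ _).mono (show (1 : ℕ∞) ≤ ⊤ from le_top) ?_
  rw [Module.End.genEigenspace_one, LinearMap.mem_ker]
  simp [hx t]

theorem isWeightAction_of_iSup (a : h →ₗ[k] Module.End k M) (ha : ∀ s t, Commute (a s) (a t))
    (htop : ⨆ wt, weightSpace a wt = ⊤) : IsWeightAction a := by
  classical
  have := DirectSum.isInternal_submodule_of_iSupIndep_of_iSup_eq_top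
    (iSupIndep_weightSpace a ha) htop
  unfold IsWeightAction
  convert this

theorem iSup_weightSpace_eq_top (a : h →ₗ[k] Module.End k M) (ha : IsWeightAction a) :
    ⨆ wt, weightSpace a wt = ⊤ := by
  classical
  have : DirectSum.IsInternal (weightSpace a) := by
    unfold IsWeightAction at ha
    convert ha
  exact this.submodule_iSup_eq_top

theorem map_iSup_weightSpace_le (a : h →ₗ[k] Module.End k M) (a' : h →ₗ[k] Module.End k M')
    (g : M →ₗ[k] M') (hg : ∀ t v, g (a t v) = a' t (g v)) :
    (⨆ wt, weightSpace a wt).map g ≤ ⨆ wt, weightSpace a' wt := by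
  rw [Submodule.map_iSup]
  refine iSup_mono fun wt => ?_
  rintro _ ⟨v, hv, rfl⟩ t
  rw [← hg, hv t, map_smul]

end General

/-! ### The grading by the number of simple roots outside `Ξ` -/

variable {k ι h : Type*} [Field k] [CharZero k] [AddCommGroup h] [Module k h]
  (D : KacMoodyDatum k ι h) (c : KacMoodyConvention) (Ξ : Set ι)

omit [CharZero k] in
theorem gradedPart_mono (ε : ℤˣ) {S S' : Set ℤ} (hS : S ⊆ S') :
    D.gradedPart c ε Ξ S ≤ D.gradedPart c ε Ξ S' :=
  biSup_mono fun _ ⟨z, hz, h⟩ => ⟨z, hS hz, h⟩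

theorem disjoint_gradedPart (ε : ℤˣ) {S S' : Set ℤ} (hS : Disjoint S S') :
    Disjoint (D.gradedPart c ε Ξ S) (D.gradedPart c ε Ξ S') := by
  refine (D.iSupIndep_rootSpace c).disjoint_biSup_biSup ?_
  rw [Set.disjoint_left] at hS ⊢
  rintro α ⟨a, ha, h1⟩ ⟨b, hb, h2⟩
  rw [h1] at h2
  have : a = b := by exact_mod_cast h2
  exact hS ha (this ▸ hb)

omit [CharZero k] in
theorem gradedPart_sup_le (ε : ℤˣ) (S S' : Set ℤ) :
    D.gradedPart c ε Ξ S ⊔ D.gradedPart c ε Ξ S' ≤ D.gradedPart c ε Ξ (S ∪ S') :=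
  sup_le (D.gradedPart_mono c Ξ ε Set.subset_union_left)
    (D.gradedPart_mono c Ξ ε Set.subset_union_right)

theorem mem_levi_iff {x : D.Alg c} : x ∈ D.levi c Ξ ↔ x ∈ D.gradedPart c 1 Ξ {0} := by
  rw [← D.leviSpace_eq c 1 Ξ]; rfl

omit [CharZero k] in
theorem rootSpace_le_gradedPart_of_eq {α : Dual k h} {x : D.Alg c} (hx : x ∈ D.rootSpace c α)
    (z : ℤ) (hα : D.offHeight Ξ α = z) : x ∈ D.gradedPart c 1 Ξ {z} :=
  D.rootSpace_le_gradedPart c 1 Ξ (Set.mem_singleton z) (by rwa [one_smul]) hx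

omit [CharZero k] in
theorem e_mem_gradedPart (i : ι) :
    D.e c i ∈ D.gradedPart c 1 Ξ {0} ∨ D.e c i ∈ D.gradedPart c 1 Ξ {1} := by
  have he : D.e c i ∈ D.rootSpace c (D.root i) := fun t => D.cartan_lie_e c t i
  by_cases hi : i ∈ Ξ
  · exact Or.inl (D.rootSpace_le_gradedPart_of_eq c Ξ he 0
      (by rw [(D.offHeight_root Ξ i).1 hi, Int.cast_zero]))
  · exact Or.inr (D.rootSpace_le_gradedPart_of_eq c Ξ he 1
      (by rw [(D.offHeight_root Ξ i).2 hi, Int.cast_one]))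

omit [CharZero k] in
theorem f_mem_gradedPart (i : ι) :
    D.f c i ∈ D.gradedPart c 1 Ξ {0} ∨ D.f c i ∈ D.gradedPart c 1 Ξ {-1} := by
  have hf : D.f c i ∈ D.rootSpace c (-D.root i) := fun t => D.cartan_lie_f c t i
  by_cases hi : i ∈ Ξ
  · exact Or.inl (D.rootSpace_le_gradedPart_of_eq c Ξ hf 0
      (by rw [map_neg, (D.offHeight_root Ξ i).1 hi, Int.cast_zero, neg_zero]))
  · exact Or.inr (D.rootSpace_le_gradedPart_of_eq c Ξ hf (-1)
      (by rw [map_neg, (D.offHeight_root Ξ i).2 hi, Int.cast_neg, Int.cast_one]))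

theorem lieSpan_local_eq_top : LieSubalgebra.lieSpan k (D.Alg c)
    (D.gradedPart c 1 Ξ {-1} ∪ D.levi c Ξ ∪ D.gradedPart c 1 Ξ {1} : Set (D.Alg c)) = ⊤ := by
  refine D.eq_top_of_generators c _ (fun i => ?_) (fun i => ?_) (fun t => ?_) <;>
    refine LieSubalgebra.subset_lieSpan ?_
  · rcases D.e_mem_gradedPart c Ξ i with h | h
    · exact Or.inl (Or.inr ((D.mem_levi_iff c Ξ).2 h))
    · exact Or.inr h
  · rcases D.f_mem_gradedPart c Ξ i with h | h
    · exact Or.inl (Or.inr ((D.mem_levi_iff c Ξ).2 h))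
    · exact Or.inl (Or.inl h)
  · exact Or.inl (Or.inr (D.cartanLevi c Ξ t).2)

theorem eq_zero_of_nilradical_add_levi_add_nilradical {x y a : D.Alg c}
    (hy : y ∈ D.nilradical c (-1) Ξ) (ha : a ∈ D.levi c Ξ) (hx : x ∈ D.nilradical c 1 Ξ)
    (h0 : y + a + x = 0) : y = 0 ∧ a = 0 ∧ x = 0 := by
  rw [nilradical_neg_eq] at hy
  rw [D.nilradical_eq c 1] at hx
  rw [mem_levi_iff] at ha
  have h1 : a + x ∈ D.gradedPart c 1 Ξ ({0} ∪ {z | 0 < z}) :=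
    D.gradedPart_sup_le c Ξ 1 _ _ (Submodule.add_mem_sup ha hx)
  have hy0 : y = 0 := by
    refine Submodule.disjoint_def.1 (D.disjoint_gradedPart c Ξ 1 ?_) y hy
      (show y ∈ D.gradedPart c 1 Ξ ({0} ∪ {z | 0 < z}) from ?_)
    · rw [Set.disjoint_left]
      rintro z (hz : z < 0) (rfl | (hz' : 0 < z)) <;> omega
    · rw [add_assoc] at h0
      rw [eq_neg_of_add_eq_zero_left h0]
      exact neg_mem h1
  have ha0 : a = 0 := by
    refine Submodule.disjoint_def.1 (D.disjoint_gradedPart c Ξ 1 ?_) a ha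
      (show a ∈ D.gradedPart c 1 Ξ {z | 0 < z} from ?_)
    · rw [Set.disjoint_left]
      rintro z rfl (hz' : (0 : ℤ) < 0)
      omega
    · rw [hy0, zero_add] at h0
      rw [eq_neg_of_add_eq_zero_left h0]
      exact neg_mem hx
  refine ⟨hy0, ha0, ?_⟩
  rwa [hy0, ha0, zero_add, zero_add] at h0

/-- The nilradical `u^±_Ξ` as a Lie subalgebra. -/
noncomputable def nilradicalSubalgebra (ε : ℤˣ) : LieSubalgebra k (D.Alg c) :=
  { D.nilradical c ε Ξ with
    lie_mem' := fun {x y} hx hy => by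
      change _ ∈ D.nilradical c ε Ξ at hx hy
      change _ ∈ D.nilradical c ε Ξ
      rw [nilradical_eq] at hx hy ⊢
      exact D.lie_mem_gradedPart c ε Ξ (fun _ ha _ hb => add_pos ha hb) hx hy }

/-- The decomposition `g = u⁻_Ξ ⊕ l_Ξ ⊕ u⁺_Ξ`, with the parts of degree `∓1` for the grading by
the number of simple roots outside `Ξ`. -/
noncomputable def localTriangular : LocalTriangular (D.levi c Ξ) where
  neg := D.nilradicalSubalgebra c Ξ (-1)
  pos := D.nilradicalSubalgebra c Ξ 1
  negGen := D.gradedPart c 1 Ξ {-1}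
  posGen := D.gradedPart c 1 Ξ {1}
  negGen_le := by
    change _ ≤ D.nilradical c (-1) Ξ
    rw [nilradical_neg_eq]
    exact D.gradedPart_mono c Ξ 1 (by simp)
  posGen_le := by
    change _ ≤ D.nilradical c 1 Ξ
    rw [nilradical_eq]
    exact D.gradedPart_mono c Ξ 1 (by simp)
  lie_negGen a ha y hy := D.lie_mem_gradedPart c 1 Ξ (by simp) ((D.mem_levi_iff c Ξ).1 ha) hy
  lie_posGen a ha y hy := D.lie_mem_gradedPart c 1 Ξ (by simp) ((D.mem_levi_iff c Ξ).1 ha) hy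
  posGen_lie_negGen x hx y hy :=
    (D.mem_levi_iff c Ξ).2 (D.lie_mem_gradedPart c 1 Ξ (by simp) hx hy)
  lieSpan_eq_top := D.lieSpan_local_eq_top c Ξ
  eq_zero _ hy _ ha _ hx h0 := D.eq_zero_of_nilradical_add_levi_add_nilradical c Ξ hy ha hx h0

end KacMoodyDatum

namespace KacMoodyDatum

attribute [local instance] LieRing.ofAssociativeRing

variable {k I h : Type*} [Field k] [CharZero k] [AddCommGroup h] [Module k h]
  (D : KacMoodyDatum k I h) (c : KacMoodyConvention) (Ξ : Set I)

open UniversalEnvelopingAlgebra (ι)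

/-! ### The transpose is an involution -/

section Transpose

omit [CharZero k]

theorem chevalley_chevalley (x : D.Alg c) : D.chevalley c (D.chevalley c x) = x := by
  obtain ⟨x, rfl⟩ := quotMk_surjective _ x
  exact congrArg (D.toAlg c) (D.auxChevalley_auxChevalley x)

theorem transpose_transpose (x : D.Alg c) : D.transpose c (D.transpose c x) = x := by
  simp only [transpose, LinearMap.neg_apply, map_neg, neg_neg]
  exact D.chevalley_chevalley c x

theorem τ_τ (X : UniversalEnvelopingAlgebra k (D.Alg c)) : D.τ c (D.τ c X) = X := by
  induction X using UniversalEnvelopingAlgebra.induction with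
  | algebraMap r => simp [τ]
  | ι x => rw [τ_ι, τ_ι, transpose_transpose]
  | mul X Y h1 h2 => rw [τ_mul, τ_mul, h1, h2]
  | add X Y h1 h2 => simp only [τ, map_add, MulOpposite.unop_add] at h1 h2 ⊢; rw [h1, h2]

end Transpose

/-! ### Parabolic subalgebras -/

theorem levi_le_parabolic (ε : ℤˣ) : D.levi c Ξ ≤ D.parabolic c ε Ξ := by
  change D.leviSpace c Ξ ≤ D.parabolicSpace c ε Ξ
  rw [D.leviSpace_eq c ε, D.parabolicSpace_eq]
  exact D.gradedPart_mono c Ξ ε (by simp)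

theorem nilradical_le_parabolic (ε : ℤˣ) : D.nilradical c ε Ξ ≤ (D.parabolic c ε Ξ).toSubmodule := by
  change D.nilradical c ε Ξ ≤ D.parabolicSpace c ε Ξ
  rw [D.nilradical_eq c ε, D.parabolicSpace_eq]
  exact D.gradedPart_mono c Ξ ε fun z (hz : 0 < z) => hz.le

theorem exists_parabolic_eq_add (ε : ℤˣ) (y : D.parabolic c ε Ξ) : ∃ (a : D.levi c Ξ),
    ∃ u ∈ D.nilradical c ε Ξ, (y : D.Alg c) = a + u ∧ D.toLevi c ε Ξ y = a := by
  obtain ⟨y, hy⟩ := y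
  obtain ⟨a, ha, u, hu, rfl⟩ := D.exists_levi_add_nilradical c ε Ξ hy
  refine ⟨⟨a, ha⟩, u, hu, rfl, Subtype.ext ?_⟩
  change (D.leviProj c Ξ (a + u) : D.Alg c) = a
  rw [map_add, D.leviProj_nilradical c ε Ξ hu, add_zero, D.leviProj_levi c Ξ ha]

theorem exists_eq_parabolic_add_nilradical (x : D.Alg c) :
    ∃ y ∈ D.parabolic c (-1) Ξ, ∃ u ∈ D.nilradical c 1 Ξ, x = y + u := by
  have hx : x ∈ D.leviSpace c Ξ ⊔ (D.nilradical c 1 Ξ ⊔ D.nilradical c (-1) Ξ) := by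
    rw [(D.isCompl_levi c 1 Ξ).sup_eq_top]; trivial
  obtain ⟨a, ha, w, hw, rfl⟩ := Submodule.mem_sup.1 hx
  obtain ⟨u, hu, v, hv, rfl⟩ := Submodule.mem_sup.1 hw
  refine ⟨a + v, add_mem (D.levi_le_parabolic c Ξ _ ha) (D.nilradical_le_parabolic c Ξ _ hv), u, hu,
    by abel⟩

variable (N : Type*) [AddCommGroup N] [Module k N] [LieRingModule (D.levi c Ξ) N]
  [LieModule k (D.levi c Ξ) N]

theorem inflate_ι (ε : ℤˣ) (y : D.parabolic c ε Ξ) (n : N) :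
    D.inflate c ε Ξ N (ι k y) n = ⁅D.toLevi c ε Ξ y, n⁆ := by
  rw [inflate, UniversalEnvelopingAlgebra.lift_ι_apply]; rfl

theorem parabolicIncl_ι (ε : ℤˣ) (y : D.parabolic c ε Ξ) :
    D.parabolicIncl c ε Ξ (ι k y) = ι k (y : D.Alg c) := by
  rw [parabolicIncl, UniversalEnvelopingAlgebra.lift_ι_apply]; rfl

variable {N}

/-! ### The module `Ind_{Ξ,!}(N)` -/

theorem lie_indShriek (x : D.Alg c) (v : D.IndShriek c Ξ N) : ⁅x, v⁆ = ι k x • v := rfl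

variable (N) in
/-- The quotient map `U(g) ⊗ N → Ind_{Ξ,!}(N)`. -/
noncomputable def indShriekMk : (UniversalEnvelopingAlgebra k (D.Alg c) ⊗[k] N)
    →ₗ[UniversalEnvelopingAlgebra k (D.Alg c)] D.IndShriek c Ξ N :=
  (D.indShriekRel c Ξ N).mkQ

theorem indShriekMk_surjective : Function.Surjective (D.indShriekMk c Ξ N) :=
  (D.indShriekRel c Ξ N).mkQ_surjective

theorem indShriekMk_eq_zero {v : UniversalEnvelopingAlgebra k (D.Alg c) ⊗[k] N}
    (hv : v ∈ D.indShriekRel c Ξ N) : D.indShriekMk c Ξ N v = 0 :=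
  (Submodule.Quotient.mk_eq_zero _).2 hv

theorem smul_oneTensor (X : UniversalEnvelopingAlgebra k (D.Alg c)) (n : N) :
    X • D.oneTensor c Ξ N n = D.indShriekMk c Ξ N (X ⊗ₜ n) := by
  change D.indShriekMk c Ξ N (X • ((1 : UniversalEnvelopingAlgebra k (D.Alg c)) ⊗ₜ[k] n)) = _
  rw [TensorProduct.smul_tmul', smul_eq_mul, mul_one]

theorem parabolicIncl_smul_oneTensor (Y : UniversalEnvelopingAlgebra k (D.parabolic c 1 Ξ))
    (n : N) : D.parabolicIncl c 1 Ξ Y • D.oneTensor c Ξ N n =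
      D.oneTensor c Ξ N (D.inflate c 1 Ξ N Y n) := by
  have h1 := D.smul_oneTensor c Ξ 1 (D.inflate c 1 Ξ N Y n)
  rw [one_smul] at h1
  rw [h1, smul_oneTensor, ← sub_eq_zero, ← map_sub]
  refine D.indShriekMk_eq_zero c Ξ (Submodule.subset_span ⟨1, Y, n, by rw [one_mul]⟩)

theorem parabolic_lie_oneTensor (y : D.parabolic c 1 Ξ) (n : N) :
    ⁅(y : D.Alg c), D.oneTensor c Ξ N n⁆ = D.oneTensor c Ξ N ⁅D.toLevi c 1 Ξ y, n⁆ := by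
  rw [lie_indShriek, ← parabolicIncl_ι, parabolicIncl_smul_oneTensor, inflate_ι]

theorem levi_lie_oneTensor (a : D.levi c Ξ) (n : N) :
    ⁅(a : D.Alg c), D.oneTensor c Ξ N n⁆ = D.oneTensor c Ξ N ⁅a, n⁆ := by
  rw [D.parabolic_lie_oneTensor c Ξ ⟨a, D.levi_le_parabolic c Ξ 1 a.2⟩ n]
  congr 2
  exact Subtype.ext (D.leviProj_levi c Ξ a.2)

theorem nilradical_lie_oneTensor {x : D.Alg c} (hx : x ∈ D.nilradical c 1 Ξ) (n : N) :
    ⁅x, D.oneTensor c Ξ N n⁆ = 0 := by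
  rw [D.parabolic_lie_oneTensor c Ξ ⟨x, D.nilradical_le_parabolic c Ξ 1 hx⟩ n]
  have : D.toLevi c 1 Ξ ⟨x, D.nilradical_le_parabolic c Ξ 1 hx⟩ = 0 :=
    Subtype.ext (congrArg Subtype.val (D.leviProj_nilradical c 1 Ξ hx))
  rw [this, zero_lie, map_zero]

/-- `1 ⊗ N` generates `Ind_{Ξ,!}(N)`. -/
theorem eq_top_of_oneTensor_mem (W : Submodule k (D.IndShriek c Ξ N))
    (h1 : ∀ n, D.oneTensor c Ξ N n ∈ W) (hW : ∀ (x : D.Alg c), ∀ v ∈ W, ⁅x, v⁆ ∈ W) : W = ⊤ := by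
  have key : ∀ X : UniversalEnvelopingAlgebra k (D.Alg c), ∀ v ∈ W, X • v ∈ W := by
    intro X
    induction X using UniversalEnvelopingAlgebra.induction with
    | algebraMap r => intro v hv; rw [algebraMap_smul]; exact W.smul_mem r hv
    | ι x => exact hW x
    | mul X Y h1 h2 => intro v hv; rw [mul_smul]; exact h1 _ (h2 v hv)
    | add X Y h1 h2 => intro v hv; rw [add_smul]; exact add_mem (h1 v hv) (h2 v hv)
  refine eq_top_iff.2 fun v _ => ?_
  obtain ⟨v, rfl⟩ := D.indShriekMk_surjective c Ξ v
  induction v using TensorProduct.induction_on with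
  | zero => rw [map_zero]; exact zero_mem W
  | tmul X n => rw [← smul_oneTensor]; exact key X _ (h1 n)
  | add v w h1 h2 => rw [map_add]; exact add_mem (h1 trivial) (h2 trivial)

/-- `1 ⊗ N` generates `Ind_{Ξ,!}(N)` already under `p⁻_Ξ`: the smallest `p⁻_Ξ`-stable subspace
containing it is also stable under `u⁺_Ξ`, which kills `1 ⊗ N`. -/
theorem eq_top_of_oneTensor_mem_of_parabolic (W : Submodule k (D.IndShriek c Ξ N))
    (h1 : ∀ n, D.oneTensor c Ξ N n ∈ W)
    (hW : ∀ y ∈ D.parabolic c (-1) Ξ, ∀ v ∈ W, ⁅y, v⁆ ∈ W) : W = ⊤ := by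
  let good : Set (Submodule k (D.IndShriek c Ξ N)) := {W | (∀ n, D.oneTensor c Ξ N n ∈ W) ∧
    ∀ y ∈ D.parabolic c (-1) Ξ, ∀ v ∈ W, ⁅y, v⁆ ∈ W}
  let W₀ := sInf good
  have h₀ : ∀ n, D.oneTensor c Ξ N n ∈ W₀ :=
    fun n => Submodule.mem_sInf.2 fun W hW => hW.1 n
  have hW₀ : ∀ y ∈ D.parabolic c (-1) Ξ, ∀ v ∈ W₀, ⁅y, v⁆ ∈ W₀ := fun y hy v hv =>
    Submodule.mem_sInf.2 fun W hW => hW.2 y hy v (Submodule.mem_sInf.1 hv W hW)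
  let W₁ : Submodule k (D.IndShriek c Ξ N) :=
    { carrier := {v | v ∈ W₀ ∧ ∀ x : D.Alg c, ⁅x, v⁆ ∈ W₀}
      add_mem' := fun {v w} hv hw => ⟨add_mem hv.1 hw.1, fun x => by
        rw [lie_add]; exact add_mem (hv.2 x) (hw.2 x)⟩
      zero_mem' := ⟨zero_mem _, fun x => by rw [lie_zero]; exact zero_mem _⟩
      smul_mem' := fun r v hv => ⟨W₀.smul_mem r hv.1, fun x => by
        rw [lie_smul]; exact W₀.smul_mem r (hv.2 x)⟩ }
  have hW₁ : W₀ ≤ W₁ := by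
    refine sInf_le ⟨fun n => ⟨h₀ n, fun x => ?_⟩, fun y hy v hv => ⟨hW₀ y hy v hv.1, fun x => ?_⟩⟩
    · obtain ⟨y, hy, u, hu, rfl⟩ := D.exists_eq_parabolic_add_nilradical c Ξ x
      rw [add_lie, nilradical_lie_oneTensor D c Ξ hu, add_zero]
      exact hW₀ y hy _ (h₀ n)
    · rw [leibniz_lie]
      exact add_mem (hv.2 _) (hW₀ y hy _ (hv.2 x))
  have htop := D.eq_top_of_oneTensor_mem c Ξ W₀ h₀ fun x v hv => (hW₁ hv).2 x
  exact eq_top_iff.2 (htop ▸ sInf_le ⟨h1, hW⟩)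

/-- The `p⁻_Ξ`-equivariant retraction of `Ind_{Ξ,!}(N)` onto `1 ⊗ N`. -/
theorem exists_retraction : ∃ P : D.IndShriek c Ξ N →ₗ[k] N,
    (∀ n, P (D.oneTensor c Ξ N n) = n) ∧
    ∀ (Y : UniversalEnvelopingAlgebra k (D.parabolic c (-1) Ξ)) v,
      P (D.parabolicIncl c (-1) Ξ Y • v) = D.inflate c (-1) Ξ N Y (P v) := by
  obtain ⟨β, hβ1, hl, hr, hneg, hpos⟩ := (D.localTriangular c Ξ).exists_harishChandra (N := N)
  have hY : ∀ Y X n, β (X * D.parabolicIncl c 1 Ξ Y) n = β X (D.inflate c 1 Ξ N Y n) := by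
    intro Y
    induction Y using UniversalEnvelopingAlgebra.induction with
    | algebraMap r =>
      intro X n
      simp [← Algebra.commutes, ← Algebra.smul_def]
    | ι y =>
      intro X n
      obtain ⟨a, u, hu, h1, h2⟩ := D.exists_parabolic_eq_add c Ξ 1 y
      rw [parabolicIncl_ι, inflate_ι, h2, h1, map_add, mul_add, map_add, hpos u hu, add_zero, hr]
    | mul Y Z h1 h2 => intro X n; rw [map_mul (D.parabolicIncl c 1 Ξ), map_mul (D.inflate c 1 Ξ N), ← mul_assoc, h2, h1]; rfl
    | add Y Z h1 h2 =>
      intro X n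
      rw [map_add, map_add, mul_add, map_add, LinearMap.add_apply, h1, h2, LinearMap.add_apply,
        map_add]
  let F : (UniversalEnvelopingAlgebra k (D.Alg c) ⊗[k] N) →ₗ[k] N := TensorProduct.lift β
  have hF : ∀ v ∈ D.indShriekRel c Ξ N, ∀ X : UniversalEnvelopingAlgebra k (D.Alg c),
      F (X • v) = 0 := by
    intro v hv
    induction hv using Submodule.span_induction with
    | mem v hv =>
      obtain ⟨X, Y, n, rfl⟩ := hv
      intro Z
      rw [smul_sub, map_sub, TensorProduct.smul_tmul', TensorProduct.smul_tmul', smul_eq_mul,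
        smul_eq_mul, ← mul_assoc]
      change β _ _ - β _ _ = 0
      rw [hY, sub_self]
    | zero => intro X; rw [smul_zero, map_zero]
    | add v w _ _ h1 h2 => intro X; rw [smul_add, map_add, h1, h2, add_zero]
    | smul Y v _ h1 => intro X; rw [smul_smul, h1]
  let P : D.IndShriek c Ξ N →ₗ[k] N :=
    ((D.indShriekRel c Ξ N).restrictScalars k).liftQ F (fun v hv => by
      simpa using hF v hv 1) ∘ₗ
      (Submodule.Quotient.restrictScalarsEquiv k (D.indShriekRel c Ξ N)).symm.toLinearMap
  have hP : ∀ X n, P (D.indShriekMk c Ξ N (X ⊗ₜ n)) = β X n := fun X n => rfl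
  refine ⟨P, fun n => ?_, fun Y => ?_⟩
  · refine (hP 1 n).trans ?_
    rw [hβ1]; rfl
  · induction Y using UniversalEnvelopingAlgebra.induction with
    | algebraMap r => intro v; simp [algebraMap_smul]
    | ι y =>
      intro v
      obtain ⟨a, u, hu, h1, h2⟩ := D.exists_parabolic_eq_add c Ξ (-1) y
      rw [parabolicIncl_ι, inflate_ι, h2, h1]
      obtain ⟨v, rfl⟩ := D.indShriekMk_surjective c Ξ v
      induction v using TensorProduct.induction_on with
      | zero => simp
      | tmul X n =>
        rw [← map_smul, TensorProduct.smul_tmul', smul_eq_mul, hP, hP, map_add, add_mul, map_add,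
          hneg u hu, add_zero, hl]
      | add v w h1 h2 => rw [map_add (D.indShriekMk c Ξ N), smul_add, map_add P, map_add P, h1, h2, lie_add]
    | mul Y Z h1 h2 => intro v; rw [map_mul, map_mul, mul_smul, h1, h2]; rfl
    | add Y Z h1 h2 =>
      intro v
      rw [map_add, map_add, add_smul, map_add, h1, h2, LinearMap.add_apply]

end KacMoodyDatum

namespace KacMoodyDatum

attribute [local instance] LieRing.ofAssociativeRing

variable {k I h : Type*} [Field k] [CharZero k] [AddCommGroup h] [Module k h]
  (D : KacMoodyDatum k I h) (c : KacMoodyConvention) (Ξ : Set I)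
  {N : Type*} [AddCommGroup N] [Module k N] [LieRingModule (D.levi c Ξ) N]
  [LieModule k (D.levi c Ξ) N]

open UniversalEnvelopingAlgebra (ι)

/-! ### Homomorphisms from `Ind_{Ξ,!}(N)` to `Ind_{Ξ,*}(N)` -/

omit [CharZero k] in
theorem τ_one : D.τ c 1 = 1 := by simp [τ]

theorem toFun_lie (x : D.Alg c) (φ : D.IndStar c Ξ N) (X : UniversalEnvelopingAlgebra k (D.Alg c)) :
    IndStar.toFun D c Ξ N ⁅x, φ⁆ X = IndStar.toFun D c Ξ N φ (ι k (D.transpose c x) * X) := rfl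

/-- A homomorphism into the coinduced module is determined by its values at `1`. -/
theorem toFun_apply_eq (Ψ : D.IndShriek c Ξ N →ₗ⁅k, D.Alg c⁆ D.IndStar c Ξ N)
    (v : D.IndShriek c Ξ N) (X : UniversalEnvelopingAlgebra k (D.Alg c)) :
    IndStar.toFun D c Ξ N (Ψ v) X = IndStar.toFun D c Ξ N (Ψ (D.τ c X • v)) 1 := by
  have key : ∀ (X Y : UniversalEnvelopingAlgebra k (D.Alg c)) v,
      IndStar.toFun D c Ξ N (Ψ (X • v)) Y = IndStar.toFun D c Ξ N (Ψ v) (D.τ c X * Y) := by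
    intro X
    induction X using UniversalEnvelopingAlgebra.induction with
    | algebraMap r =>
      intro Y v
      have : D.τ c (algebraMap k _ r) = algebraMap k _ r := by simp [τ]
      rw [this, algebraMap_smul, map_smul, map_smul, ← Algebra.smul_def, map_smul]
      rfl
    | ι x =>
      intro Y v
      rw [τ_ι, ← toFun_lie, ← LieModuleHom.map_lie]
      rfl
    | mul X Z h1 h2 => intro Y v; rw [mul_smul, h1, h2, τ_mul, mul_assoc]
    | add X Z h1 h2 =>
      intro Y v
      have : D.τ c (X + Z) = D.τ c X + D.τ c Z := by simp [τ]
      rw [add_smul, map_add, map_add, LinearMap.add_apply, h1, h2, this, add_mul, map_add]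
  rw [key, D.τ_τ, mul_one]

theorem toFun_parabolic_lie (Ψ : D.IndShriek c Ξ N →ₗ⁅k, D.Alg c⁆ D.IndStar c Ξ N)
    (y : D.parabolic c (-1) Ξ) (v : D.IndShriek c Ξ N) :
    IndStar.toFun D c Ξ N (Ψ ⁅(y : D.Alg c), v⁆) 1 =
      ⁅D.toLevi c (-1) Ξ y, IndStar.toFun D c Ξ N (Ψ v) 1⁆ := by
  rw [LieModuleHom.map_lie, toFun_lie, mul_one, ← τ_ι, ← inflate_ι, ← parabolicIncl_ι]
  have := (Ψ v).2 (ι k y) 1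
  rw [one_mul] at this
  exact this

theorem exists_naturalMap : ∃ Φ : D.IndShriek c Ξ N →ₗ⁅k, D.Alg c⁆ D.IndStar c Ξ N,
    D.IsNaturalMap c Ξ N Φ := by
  obtain ⟨P, hP1, hP⟩ := D.exists_retraction c Ξ (N := N)
  let τL : UniversalEnvelopingAlgebra k (D.Alg c) →ₗ[k] UniversalEnvelopingAlgebra k (D.Alg c) :=
    (MulOpposite.opLinearEquiv k).symm.toLinearMap ∘ₗ (D.transposeHom c).toLinearMap
  have hτ : ∀ X, τL X = D.τ c X := fun _ => rfl
  let φ : D.IndShriek c Ξ N → UniversalEnvelopingAlgebra k (D.Alg c) →ₗ[k] N := fun v =>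
    P ∘ₗ (LinearMap.toSpanSingleton (UniversalEnvelopingAlgebra k (D.Alg c)) _ v).restrictScalars k
      ∘ₗ τL
  have hφ : ∀ v X, φ v X = P (D.τ c X • v) := fun _ _ => rfl
  refine ⟨{ toFun := fun v => ⟨φ v, fun Y X => ?_⟩, map_add' := ?_, map_smul' := ?_, map_lie' := ?_ },
    fun n => ?_⟩
  · rw [hφ, hφ, τ_mul, τ_τ, mul_smul, hP]
  · intro v w
    refine IndStar.ext D c Ξ N fun X => ?_
    change φ (v + w) X = φ v X + φ w X
    rw [hφ, hφ, hφ, smul_add, map_add]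
  · intro r v
    refine IndStar.ext D c Ξ N fun X => ?_
    change φ (r • v) X = r • φ v X
    rw [hφ, hφ, smul_comm, map_smul]
  · intro x v
    refine IndStar.ext D c Ξ N fun X => ?_
    change φ ⁅x, v⁆ X = φ v (ι k (D.transpose c x) * X)
    rw [hφ, hφ, τ_mul, τ_ι, transpose_transpose, mul_smul]
    rfl
  · change φ (D.oneTensor c Ξ N n) 1 = n
    rw [hφ, τ_one, one_smul, hP1]

theorem IsNaturalMap.unique {Φ Ψ : D.IndShriek c Ξ N →ₗ⁅k, D.Alg c⁆ D.IndStar c Ξ N}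
    (hΦ : D.IsNaturalMap c Ξ N Φ) (hΨ : D.IsNaturalMap c Ξ N Ψ) : Ψ = Φ := by
  let W : Submodule k (D.IndShriek c Ξ N) :=
    { carrier := {v | IndStar.toFun D c Ξ N (Ψ v) 1 = IndStar.toFun D c Ξ N (Φ v) 1}
      add_mem' := fun {v w} hv hw => by
        simp only [Set.mem_ofPred_eq, map_add, LinearMap.add_apply] at hv hw ⊢
        rw [hv, hw]
      zero_mem' := by simp
      smul_mem' := fun r v hv => by
        simp only [Set.mem_ofPred_eq, map_smul, LinearMap.smul_apply] at hv ⊢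
        rw [hv] }
  have hW : W = ⊤ := by
    refine D.eq_top_of_oneTensor_mem_of_parabolic c Ξ W (fun n => (hΨ n).trans (hΦ n).symm) ?_
    intro y hy v hv
    have h1 := D.toFun_parabolic_lie c Ξ Ψ ⟨y, hy⟩ v
    have h2 := D.toFun_parabolic_lie c Ξ Φ ⟨y, hy⟩ v
    exact h1.trans ((congrArg _ hv).trans h2.symm)
  refine LieModuleHom.ext fun v => IndStar.ext D c Ξ N fun X => ?_
  rw [D.toFun_apply_eq, D.toFun_apply_eq c Ξ Φ]
  exact (hW ▸ Submodule.mem_top : D.τ c X • v ∈ W)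

theorem le_ker_of_toFun_one_eq_zero (Φ : D.IndShriek c Ξ N →ₗ⁅k, D.Alg c⁆ D.IndStar c Ξ N)
    (M : LieSubmodule k (D.Alg c) (D.IndShriek c Ξ N))
    (hM : ∀ v ∈ M, IndStar.toFun D c Ξ N (Φ v) 1 = 0) : M ≤ Φ.ker := by
  intro v hv
  rw [LieModuleHom.mem_ker]
  refine IndStar.ext D c Ξ N fun X => ?_
  rw [toFun_apply_eq, map_zero, LinearMap.zero_apply]
  refine hM _ ?_
  have key : ∀ X : UniversalEnvelopingAlgebra k (D.Alg c), ∀ v ∈ M, X • v ∈ M := by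
    intro X
    induction X using UniversalEnvelopingAlgebra.induction with
    | algebraMap r => intro v hv; rw [algebraMap_smul]; exact M.smul_mem r hv
    | ι x => exact fun v hv => M.lie_mem hv
    | mul X Y h1 h2 => intro v hv; rw [mul_smul]; exact h1 _ (h2 v hv)
    | add X Y h1 h2 => intro v hv; rw [add_smul]; exact add_mem (h1 v hv) (h2 v hv)
  exact key _ v hv

/-! ### Weight decompositions -/

section WeightModule

omit [CharZero k] in
theorem cartan_commute (M : Type*) [AddCommGroup M] [Module k M] [LieRingModule (D.Alg c) M]
    [LieModule k (D.Alg c) M] (s t : h) :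
    Commute (LieModule.toEnd k (D.Alg c) M (D.cartan c s))
      (LieModule.toEnd k (D.Alg c) M (D.cartan c t)) := by
  rw [commute_iff_lie_eq, ← LieHom.map_lie, cartan_lie_cartan, map_zero]

theorem iSup_weightSpace_indShriek (hN : D.IsLeviWeightModule c Ξ N) :
    ⨆ wt, weightSpace ((LieModule.toEnd k (D.Alg c) (D.IndShriek c Ξ N) :
      D.Alg c →ₗ[k] Module.End k (D.IndShriek c Ξ N)) ∘ₗ D.cartan c) wt = ⊤ := by
  set a := (LieModule.toEnd k (D.Alg c) (D.IndShriek c Ξ N) :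
      D.Alg c →ₗ[k] Module.End k (D.IndShriek c Ξ N)) ∘ₗ D.cartan c with ha
  refine D.eq_top_of_oneTensor_mem c Ξ _ (fun n => ?_) ?_
  · refine map_iSup_weightSpace_le _ a (D.oneTensor c Ξ N) (fun t v => ?_)
      ⟨n, (iSup_weightSpace_eq_top _ hN).symm ▸ Submodule.mem_top, rfl⟩
    exact (D.levi_lie_oneTensor c Ξ (D.cartanLevi c Ξ t) v).symm
  · intro x v hv
    have hx : x ∈ ⨆ α, D.rootSpace c α := by rw [iSup_rootSpace]; trivial
    induction hx using Submodule.iSup_induction' with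
    | mem α x hx =>
      induction hv using Submodule.iSup_induction' with
      | mem wt v hv =>
        refine Submodule.mem_iSup_of_mem (α + wt) fun t => ?_
        have hv' : ⁅D.cartan c t, v⁆ = wt t • v := hv t
        change ⁅D.cartan c t, ⁅x, v⁆⁆ = _
        rw [leibniz_lie, hx t, hv', smul_lie, lie_smul, LinearMap.add_apply, add_smul]
      | zero => rw [lie_zero]; exact zero_mem _
      | add v w _ _ h1 h2 => rw [lie_add]; exact add_mem h1 h2
    | zero => rw [zero_lie]; exact zero_mem _
    | add x y _ _ h1 h2 => rw [add_lie]; exact add_mem h1 h2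

theorem isWeightModule_range (hN : D.IsLeviWeightModule c Ξ N)
    (Φ : D.IndShriek c Ξ N →ₗ⁅k, D.Alg c⁆ D.IndStar c Ξ N) : D.IsWeightModule c Φ.range := by
  refine isWeightAction_of_iSup _ (fun s t => D.cartan_commute c Φ.range s t) (eq_top_iff.2 ?_)
  rintro ⟨_, v, rfl⟩ -
  exact map_iSup_weightSpace_le
    ((LieModule.toEnd k (D.Alg c) (D.IndShriek c Ξ N) : D.Alg c →ₗ[k] _) ∘ₗ D.cartan c)
    ((LieModule.toEnd k (D.Alg c) Φ.range : D.Alg c →ₗ[k] _) ∘ₗ D.cartan c)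
    ((Φ : D.IndShriek c Ξ N →ₗ[k] D.IndStar c Ξ N).codRestrict Φ.range.toSubmodule
      (fun v => ⟨v, rfl⟩)) (fun t v => Subtype.ext (Φ.map_lie (D.cartan c t) v))
    ⟨v, (D.iSup_weightSpace_indShriek c Ξ hN).symm ▸ Submodule.mem_top, rfl⟩

end WeightModule

/-! ### The component of degree zero -/

section Grading

variable [FiniteDimensional k h]

/-- The element of the Cartan subalgebra whose adjoint action is the grading by the number of
simple roots outside `Ξ`. -/
noncomputable def gradingElement : h := (Module.evalEquiv k h).symm (D.offHeight Ξ)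

omit [CharZero k] in
theorem apply_gradingElement (α : Dual k h) : α (D.gradingElement Ξ) = D.offHeight Ξ α := by
  rw [gradingElement, Module.apply_evalEquiv_symm_apply]

theorem gradingElement_lie_levi {x : D.Alg c} (hx : x ∈ D.levi c Ξ) :
    ⁅D.cartan c (D.gradingElement Ξ), x⁆ = 0 := by
  have : D.gradedPart c 1 Ξ {0} ≤
      LinearMap.ker (LieAlgebra.ad k (D.Alg c) (D.cartan c (D.gradingElement Ξ))) := by
    refine iSup₂_le fun α ⟨z, hz, hα⟩ x hx => ?_
    rw [one_smul, show z = 0 from hz, Int.cast_zero] at hα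
    rw [LinearMap.mem_ker, LieAlgebra.ad_apply, hx, apply_gradingElement, hα, zero_smul]
  exact this ((D.mem_levi_iff c Ξ).1 hx)

/-- The grading element is central in the Levi subalgebra, hence acts on a simple weight module by
a scalar. -/
theorem exists_gradingElement_lie_eq_smul (hN : D.IsLeviWeightModule c Ξ N)
    (hs : LieModule.IsIrreducible k (D.levi c Ξ) N) :
    ∃ s : k, ∀ n : N, ⁅D.cartanLevi c Ξ (D.gradingElement Ξ), n⁆ = s • n := by
  have := LieModule.nontrivial_of_isIrreducible k (D.levi c Ξ) N
  have htop := iSup_weightSpace_eq_top _ hN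
  obtain ⟨wt, hwt⟩ : ∃ wt, weightSpace ((LieModule.toEnd k (D.levi c Ξ) N :
      D.levi c Ξ →ₗ[k] Module.End k N) ∘ₗ D.cartanLevi c Ξ) wt ≠ ⊥ := by
    by_contra! hcon
    simp only [hcon, iSup_bot] at htop
    exact bot_ne_top htop
  let E : LieSubmodule k (D.levi c Ξ) N :=
    { carrier := {n | ⁅D.cartanLevi c Ξ (D.gradingElement Ξ), n⁆ = wt (D.gradingElement Ξ) • n}
      add_mem' := fun {v w} (hv : _ = _) (hw : _ = _) => by
        change _ = _
        rw [lie_add, hv, hw, smul_add]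
      zero_mem' := by change _ = _; rw [lie_zero, smul_zero]
      smul_mem' := fun r v (hv : _ = _) => by
        change _ = _
        rw [lie_smul, hv, smul_comm]
      lie_mem := fun {x v} (hv : _ = _) => by
        change _ = _
        have : ⁅D.cartanLevi c Ξ (D.gradingElement Ξ), x⁆ = 0 :=
          Subtype.ext (D.gradingElement_lie_levi c Ξ x.2)
        rw [leibniz_lie, this, zero_lie, zero_add, hv, lie_smul] }
  obtain ⟨n, hn, hn0⟩ := Submodule.exists_mem_ne_zero_of_ne_bot hwt
  have hE : E = ⊤ := (IsSimpleOrder.eq_bot_or_eq_top E).resolve_left fun hb => hn0 (by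
    have : n ∈ E := hn (D.gradingElement Ξ)
    rwa [hb, LieSubmodule.mem_bot] at this)
  exact ⟨_, fun n => (hE ▸ LieSubmodule.mem_top n : n ∈ E)⟩

/-- `Ind_{Ξ,!}(N)` is the sum of `1 ⊗ N`, on which the grading element acts by a scalar `s`, and of
its eigenspaces for the eigenvalues `s - 1, s - 2, …`. -/
theorem range_oneTensor_sup_eigenspace {s : k}
    (hs : ∀ n : N, ⁅D.cartanLevi c Ξ (D.gradingElement Ξ), n⁆ = s • n) :
    LinearMap.range (D.oneTensor c Ξ N) ⊔ ⨆ m : ℕ, (LieModule.toEnd k (D.Alg c)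
      (D.IndShriek c Ξ N) (D.cartan c (D.gradingElement Ξ))).eigenspace (s - (m + 1 : ℕ)) = ⊤ := by
  set T := LieModule.toEnd k (D.Alg c) (D.IndShriek c Ξ N) (D.cartan c (D.gradingElement Ξ))
  have h1 : ∀ n, T (D.oneTensor c Ξ N n) = s • D.oneTensor c Ξ N n := fun n => by
    rw [← map_smul, ← hs]
    exact D.levi_lie_oneTensor c Ξ (D.cartanLevi c Ξ (D.gradingElement Ξ)) n
  have h2 : ∀ {α : Dual k h} {x : D.Alg c} {μ : k} {v : D.IndShriek c Ξ N}, x ∈ D.rootSpace c α →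
      T v = μ • v → T ⁅x, v⁆ = (μ + D.offHeight Ξ α) • ⁅x, v⁆ := by
    intro α x μ v hx hv
    change ⁅D.cartan c (D.gradingElement Ξ), v⁆ = _ at hv
    change ⁅D.cartan c (D.gradingElement Ξ), ⁅x, v⁆⁆ = _
    rw [leibniz_lie, hx, hv, smul_lie, lie_smul, apply_gradingElement, ← add_smul, add_comm]
  set W := LinearMap.range (D.oneTensor c Ξ N) ⊔ ⨆ m : ℕ, T.eigenspace (s - (m + 1 : ℕ)) with hW
  have hm : ∀ (m : ℕ) v, T v = (s - (m + 1 : ℕ)) • v → v ∈ W := fun m v hv =>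
    Submodule.mem_sup_right (Submodule.mem_iSup_of_mem m (Module.End.mem_eigenspace_iff.2 hv))
  have hWind : ∀ (U : Submodule k (D.IndShriek c Ξ N)), (∀ n, D.oneTensor c Ξ N n ∈ U) →
      (∀ (m : ℕ) v, T v = (s - (m + 1 : ℕ)) • v → v ∈ U) → W ≤ U := fun U hU1 hU2 =>
    sup_le (by rintro _ ⟨n, rfl⟩; exact hU1 n)
      (iSup_le fun m v hv => hU2 m v (Module.End.mem_eigenspace_iff.1 hv))
  have hlevi : ∀ a ∈ D.levi c Ξ, ∀ v ∈ W, ⁅a, v⁆ ∈ W := by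
    intro a ha
    refine hWind (W.comap (LieModule.toEnd k (D.Alg c) _ a)) (fun n => ?_) (fun m v hv => ?_)
    · change ⁅a, _⁆ ∈ W
      rw [D.levi_lie_oneTensor c Ξ ⟨a, ha⟩ n]
      exact Submodule.mem_sup_left ⟨_, rfl⟩
    · refine hm m _ ?_
      change ⁅D.cartan c (D.gradingElement Ξ), v⁆ = _ at hv
      change ⁅D.cartan c (D.gradingElement Ξ), ⁅a, v⁆⁆ = _ • ⁅a, v⁆
      rw [leibniz_lie, D.gradingElement_lie_levi c Ξ ha, zero_lie, zero_add, hv, lie_smul]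
  have hnil : D.nilradical c (-1) Ξ ≤ ⨅ v : W, W.comap
      ((LieModule.toEnd k (D.Alg c) (D.IndShriek c Ξ N) :
        D.Alg c →ₗ[k] Module.End k (D.IndShriek c Ξ N)).flip (v : D.IndShriek c Ξ N)) := by
    rw [D.nilradical_neg_eq c 1 Ξ]
    refine iSup₂_le fun α ⟨z, (hz : z < 0), hα⟩ x hx => ?_
    rw [Submodule.mem_iInf]
    rintro ⟨v, hv⟩
    change ⁅x, v⁆ ∈ W
    rw [one_smul] at hα
    obtain ⟨p, hp⟩ : ∃ p : ℕ, z = -(p + 1 : ℕ) := ⟨(-z - 1).toNat, by omega⟩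
    refine hWind (W.comap (LieModule.toEnd k (D.Alg c) _ x)) (fun n => ?_) (fun m v hv => ?_) hv
    · refine hm p _ ((h2 hx (h1 n)).trans ?_)
      rw [hα, hp]
      push_cast
      rw [← sub_eq_add_neg]
      rfl
    · refine hm (p + m + 1) _ ((h2 hx hv).trans ?_)
      have : s - ((m + 1 : ℕ) : k) + D.offHeight Ξ α = s - ((p + m + 1 + 1 : ℕ) : k) := by
        rw [hα, hp]
        push_cast
        ring
      rw [this]
      rfl
  refine D.eq_top_of_oneTensor_mem_of_parabolic c Ξ W
    (fun n => Submodule.mem_sup_left ⟨n, rfl⟩) fun y hy v hv => ?_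
  obtain ⟨a, ha, u, hu, rfl⟩ := D.exists_levi_add_nilradical c (-1) Ξ hy
  rw [add_lie]
  exact add_mem (hlevi a ha v hv) ((Submodule.mem_iInf _).1 (hnil hu) ⟨v, hv⟩)

/-- A submodule of `Ind_{Ξ,!}(N)` meeting `1 ⊗ N` trivially lies in the kernel of every homomorphism
to `Ind_{Ξ,*}(N)`: it contains the component in `1 ⊗ N` of each of its elements, and the other
components, of different degree, have value `0` at `1`. -/
theorem le_ker_of_disjoint_oneTensor
    (Φ : D.IndShriek c Ξ N →ₗ⁅k, D.Alg c⁆ D.IndStar c Ξ N) {s : k}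
    (hs : ∀ n : N, ⁅D.cartanLevi c Ξ (D.gradingElement Ξ), n⁆ = s • n)
    (M : LieSubmodule k (D.Alg c) (D.IndShriek c Ξ N))
    (hM : Disjoint M.toSubmodule (LinearMap.range (D.oneTensor c Ξ N))) : M ≤ Φ.ker := by
  refine D.le_ker_of_toFun_one_eq_zero c Ξ Φ M fun v hv => ?_
  set T := LieModule.toEnd k (D.Alg c) (D.IndShriek c Ξ N) (D.cartan c (D.gradingElement Ξ))
  have hv' : v ∈ LinearMap.range (D.oneTensor c Ξ N) ⊔
      ⨆ m : ℕ, T.eigenspace (s - (m + 1 : ℕ)) := by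
    rw [D.range_oneTensor_sup_eigenspace c Ξ hs]; trivial
  obtain ⟨_, ⟨n, rfl⟩, w, hw, rfl⟩ := Submodule.mem_sup.1 hv'
  have hne : ∀ m : ℕ, s - ((m + 1 : ℕ) : k) ≠ s := fun m hm => by
    rw [sub_eq_self] at hm
    exact Nat.cast_ne_zero.2 m.succ_ne_zero hm
  have h1 : T (D.oneTensor c Ξ N n) = s • D.oneTensor c Ξ N n := by
    rw [← map_smul, ← hs]
    exact D.levi_lie_oneTensor c Ξ (D.cartanLevi c Ξ (D.gradingElement Ξ)) n
  have hn : D.oneTensor c Ξ N n ∈ M.toSubmodule :=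
    T.mem_of_add_mem_of_mem_iSup_eigenspace M.toSubmodule (fun v hv => M.lie_mem hv) h1
      ((iSup_le fun m => le_biSup T.eigenspace (hne m) : (_ : Submodule k _) ≤ _) hw) hv
  have hn0 : D.oneTensor c Ξ N n = 0 := Submodule.disjoint_def.1 hM _ hn ⟨n, rfl⟩
  have hw0 : (⨆ m : ℕ, T.eigenspace (s - (m + 1 : ℕ))) ≤
      LinearMap.ker ((IndStar.toFun D c Ξ N).flip 1 ∘ₗ
        (Φ : D.IndShriek c Ξ N →ₗ[k] D.IndStar c Ξ N)) := by
    refine iSup_le fun m w hw => ?_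
    rw [Module.End.mem_eigenspace_iff] at hw
    -- evaluation at `1` commutes with the grading element, which acts on `N` by `s`
    have h3 := D.toFun_parabolic_lie c Ξ Φ
      ⟨_, D.levi_le_parabolic c Ξ (-1) (D.cartanLevi c Ξ (D.gradingElement Ξ)).2⟩ w
    have h4 : D.toLevi c (-1) Ξ
        ⟨_, D.levi_le_parabolic c Ξ (-1) (D.cartanLevi c Ξ (D.gradingElement Ξ)).2⟩ =
        D.cartanLevi c Ξ (D.gradingElement Ξ) :=
      Subtype.ext (D.leviProj_levi c Ξ (D.cartanLevi c Ξ (D.gradingElement Ξ)).2)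
    rw [h4, hs] at h3
    have h5 : IndStar.toFun D c Ξ N (Φ (T w)) 1 = s • IndStar.toFun D c Ξ N (Φ w) 1 := h3
    rw [hw, map_smul, map_smul, LinearMap.smul_apply, ← sub_eq_zero, ← sub_smul,
      smul_eq_zero] at h5
    exact h5.resolve_left (sub_ne_zero.2 (hne m))
  rw [map_add, map_add, hn0, map_zero, map_zero, zero_add]
  exact hw0 hw

end Grading

end KacMoodyDatum

/-! ### Minimal parabolic induction of a simple weight module -/

theorem mainTheorem1 {k ι h : Type*} [Field k] [IsAlgClosed k] [CharZero k] [Finite ι]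
    [AddCommGroup h] [Module k h] [FiniteDimensional k h]
    (D : KacMoodyDatum k ι h) (c : KacMoodyConvention) (Ξ : Set ι)
    (N : Type*) [AddCommGroup N] [Module k N]
    [LieRingModule (D.levi c Ξ) N] [LieModule k (D.levi c Ξ) N]
    (hweight : D.IsLeviWeightModule c Ξ N)
    (hsimple : LieModule.IsIrreducible k (D.levi c Ξ) N) :
    ∃ Φ : D.IndShriek c Ξ N →ₗ⁅k, D.Alg c⁆ D.IndStar c Ξ N,
      D.IsNaturalMap c Ξ N Φ ∧
      (∀ Ψ : D.IndShriek c Ξ N →ₗ⁅k, D.Alg c⁆ D.IndStar c Ξ N,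
        D.IsNaturalMap c Ξ N Ψ → Ψ = Φ) ∧
      D.IsWeightModule c Φ.range ∧
      LieModule.IsIrreducible k (D.Alg c) Φ.range ∧
      ∀ M : LieSubmodule k (D.Alg c) (D.IndShriek c Ξ N),
        M ≤ Φ.ker ↔ Disjoint M.toSubmodule (LinearMap.range (D.oneTensor c Ξ N)) := by
  obtain ⟨Φ, hΦ⟩ := D.exists_naturalMap c Ξ (N := N)
  obtain ⟨s, hs⟩ := D.exists_gradingElement_lie_eq_smul c Ξ hweight hsimple
  have hinj : ∀ n, Φ (D.oneTensor c Ξ N n) = 0 → n = 0 := fun n hn => by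
    have := hΦ n
    rwa [hn, map_zero, LinearMap.zero_apply, eq_comm] at this
  refine ⟨Φ, hΦ, fun Ψ hΨ => hΦ.unique D c Ξ hΨ, D.isWeightModule_range c Ξ hweight Φ, ?_,
    fun M => ⟨fun hM => ?_, D.le_ker_of_disjoint_oneTensor c Ξ Φ hs M⟩⟩
  · have := LieModule.nontrivial_of_isIrreducible k (D.levi c Ξ) N
    obtain ⟨n₀, hn₀⟩ := exists_ne (0 : N)
    have : Nontrivial Φ.range :=
      ⟨⟨Φ (D.oneTensor c Ξ N n₀), ⟨_, rfl⟩⟩, 0, fun h0 => hn₀ (hinj _ (congrArg Subtype.val h0))⟩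
    refine LieModule.IsIrreducible.mk fun M hM => ?_
    -- the preimage of `M` in `Ind_{Ξ,!}(N)`
    let M' : LieSubmodule k (D.Alg c) (D.IndShriek c Ξ N) := (M.map Φ.range.incl).comap Φ
    have hM' : ∀ v, v ∈ M' ↔ (⟨Φ v, ⟨v, rfl⟩⟩ : Φ.range) ∈ M := by
      intro v
      rw [LieSubmodule.mem_comap, LieSubmodule.mem_map]
      exact ⟨fun ⟨m, hm, h⟩ => (Subtype.ext h : m = ⟨Φ v, _⟩) ▸ hm, fun h => ⟨_, h, rfl⟩⟩
    have hnd : ¬ Disjoint M'.toSubmodule (LinearMap.range (D.oneTensor c Ξ N)) := by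
      intro hd
      refine hM ((LieSubmodule.eq_bot_iff M).2 ?_)
      rintro ⟨_, v, rfl⟩ hv
      exact Subtype.ext (LieModuleHom.mem_ker.1
        (D.le_ker_of_disjoint_oneTensor c Ξ Φ hs M' hd ((hM' v).2 hv)))
    let N' : LieSubmodule k (D.levi c Ξ) N :=
      { M'.toSubmodule.comap (D.oneTensor c Ξ N) with
        lie_mem := fun {a n} hn => by
          change D.oneTensor c Ξ N ⁅a, n⁆ ∈ M'
          rw [← D.levi_lie_oneTensor c Ξ a n]
          exact M'.lie_mem hn }
    have hN' : N' = ⊤ := (IsSimpleOrder.eq_bot_or_eq_top N').resolve_left fun hb => hnd (by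
      refine Submodule.disjoint_def.2 ?_
      rintro _ hv ⟨n, rfl⟩
      have : n ∈ N' := hv
      rw [hb, LieSubmodule.mem_bot] at this
      rw [this, map_zero])
    have htop : M'.toSubmodule = ⊤ := D.eq_top_of_oneTensor_mem c Ξ _
      (fun n => (hN' ▸ LieSubmodule.mem_top n : n ∈ N')) fun x v hv => M'.lie_mem hv
    refine eq_top_iff.2 ?_
    rintro ⟨_, v, rfl⟩ -
    exact (hM' v).1 (htop ▸ Submodule.mem_top : v ∈ M'.toSubmodule)
  · refine Submodule.disjoint_def.2 ?_
    rintro _ hv ⟨n, rfl⟩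
    rw [hinj n (LieModuleHom.mem_ker.1 (hM hv)), map_zero]
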